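/- Let $k\ge 2$ be an integer and let $\chi_0$ be the principal Dirichlet character modulo $k$. For a Dirichlet character $\chi$ modulo $k$ write $G(n,\chi)=\sum_{v=0}^{k-1}\chi(v)e^{2\pi i nv/k}$ $(n\in\mathbb Z)$, and let $c_k(n)=\sum_{1\le v\le k,\ (v,k)=1}e^{2\pi i nv/k}$. For a sequence $A=\{f(n)\}_{n\in\mathbb Z}$ of period $k$ put $$P_1(0,A)=\sum_{m=0}^{k-1}f(-m)\,P_1\!\left(\tfrac mk\right),\qquad P_1(x)=x-[x]-\tfrac12 .$$ Let $\chi_1,\chi_2$ be Dirichlet characters modulo $k$ with $\chi_1(-1)\chi_2(-1)=1$, which are either both principal or both non-principal, put $G_j=\{G(n,\chi_j)\}_n$, and let $\gamma,\theta>0$ with $\gamma\theta=\pi^2/k^2$. Then $$\sum_{n=1}^\infty\sum_{v=0}^{k-1}\frac{\chi_1(v)\chi_2(n)}{n\left(1-e^{2\pi iv/k-2n\gamma}\right)}-\chi_2(-1)\sum_{n=1}^\infty\sum_{v=0}^{k-1}\frac{\chi_2(v)\chi_1(n)}{n\left(1-e^{2\pi iv/k-2n\theta}\right)}=\frac{\pi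 i}{k}\chi_1(-1)P_1(0,G_1)P_1(0,G_2)+\delta,$$ where, with $z=\pi i/(k\gamma)$ and the principal branch of the logarithm, $$\delta=\begin{cases}\dfrac{c_k(0)}{k}\,P_1(0,c_k)\log z,&\chi_1=\chi_2=\chi_0,\\[1ex]0,&\chi_1\ne\chi_0\text{ and }\chi_2\ne\chi_0.\end{cases}$$ If $\chi_1,\chi_2\neq\chi_0$, both series over $n$ converge absolutely. If $\chi_1=\chi_2=\chi_0$, the left-hand side is understood as the single series over $n$ of the differences of the $n$-th terms, which converges absolutely (the two series diverge separately). In particular: (a) for the character $\chi$ modulo $6$ with $\chi(5)=-1$ and $\gamma,\theta>0$, $\gamma\theta=\pi^2/36$, $$\sum_{n=1}^\infty\frac{\chi(n)}{n\,(2\cosh(2n\gamma)-1)}+\sum_{n=1}^\infty\frac{\chi(n)}{n\,(2\cosh(2n\theta)-1)}=\frac{\pi}{2\sqrt3};$$ (b) for the character $\chi$ modulo $3$ with $\chi(2)=-1$ and $\gamma,\theta>0$, $\gamma\theta=\pi^2/9$, $$\sum_{n=1}^\infty\frac{\chi(n)}{n\,(2\cosh(2n\gamma)+1)}+\sum_{n=1}^\infty\frac{\chi(n)}{n\,(2\cosh(2n\theta)+1)}=\frac{\pi}{9\sqrt3},$$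 all four series being absolutely convergent. -/

import Mathlib

noncomputable section

namespace CharSeries

/-- The `n`-th Bernoulli function `P_n`, given by `n! P_n(x) = B_n(x - [x])`. -/
def bernoulliP (n : ℕ) (x : ℝ) : ℝ :=
  bernoulliFun n (Int.fract x) / (n.factorial : ℝ)

/-- The periodic Bernoulli function `P_n(x, A)` attached to a sequence `A = {f(m)}` of
period `k`: `P_0(x, A) = (1/k) ∑_{m<k} f(m)` and, for `n ≥ 1`,
`P_n(x, A) = k^(n-1) ∑_{m<k} f(-m) P_n((m+x)/k)`. -/
def periodicBernoulliP (k : ℕ) : ℕ → ℝ → (ℤ → ℂ) → ℂ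
  | 0, _, f => (1 / (k : ℂ)) * ∑ m ∈ Finset.range k, f (m : ℤ)
  | n + 1, x, f => (k : ℂ) ^ n * ∑ m ∈ Finset.range k,
      f (-(m : ℤ)) * ((bernoulliP (n + 1) (((m : ℝ) + x) / (k : ℝ)) : ℝ) : ℂ)

/-- The Gauss sum `G(n, χ) = ∑_{v<k} χ(v) e^(2πinv/k)`. -/
def charGauss {k : ℕ} (χ : DirichletCharacter ℂ k) (n : ℤ) : ℂ :=
  ∑ v ∈ Finset.range k,
    χ (v : ZMod k) * Complex.exp (2 * (Real.pi : ℂ) * Complex.I * (n : ℂ) * (v : ℂ) / (k : ℂ))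

/-- The Ramanujan sum `c_k(n) = ∑_{1 ≤ v ≤ k, (v,k)=1} e^(2πinv/k)`. -/
def ramanujanSum (k : ℕ) (n : ℤ) : ℂ :=
  ∑ v ∈ (Finset.Icc 1 k).filter (fun v => Nat.Coprime v k),
    Complex.exp (2 * (Real.pi : ℂ) * Complex.I * (n : ℂ) * (v : ℂ) / (k : ℂ))

open Classical in
/-- The logarithmic term `δ(z; c, d; χ₁, χ₂)`: it is `(c_k(0)/k) P_1(0, c_k) log(cz+d)` when both
characters are principal and `0` when both are non-principal. (It is only used in these two
cases.) -/
def logTerm {k : ℕ} (z : ℂ) (c d : ℤ) (χ₁ χ₂ : DirichletCharacter ℂ k) : ℂ :=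
  if χ₁ = 1 ∧ χ₂ = 1 then
    ramanujanSum k 0 / (k : ℂ) * periodicBernoulliP k 1 0 (ramanujanSum k)
      * Complex.log ((c : ℂ) * z + (d : ℂ))
  else 0

/-- The `n`-th term `∑_{v<k} χ₁(v) χ₂(n) / (n (1 - e^(2πiv/k - 2nγ)))` of the double series. -/
def seriesTerm {k : ℕ} (χ₁ χ₂ : DirichletCharacter ℂ k) (γ : ℝ) (n : ℕ) : ℂ :=
  ∑ v ∈ Finset.range k,
    χ₁ (v : ZMod k) * χ₂ (n : ZMod k) /
      ((n : ℂ) * (1 - Complex.exp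
        (2 * (Real.pi : ℂ) * Complex.I * (v : ℂ) / (k : ℂ) - 2 * (n : ℂ) * (γ : ℂ))))

/-- The right-hand side `(πi/k) χ₁(-1) P_1(0, G₁) P_1(0, G₂) + δ(z; 1, 0; χ₁, χ₂)`,
where `z = πi/(kγ)`. -/
def rightSide {k : ℕ} (χ₁ χ₂ : DirichletCharacter ℂ k) (γ : ℝ) : ℂ :=
  (Real.pi : ℂ) * Complex.I / (k : ℂ) * χ₁ (-1)
      * periodicBernoulliP k 1 0 (charGauss χ₁) * periodicBernoulliP k 1 0 (charGauss χ₂)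
    + logTerm ((Real.pi : ℂ) * Complex.I / ((k : ℂ) * (γ : ℂ))) 1 0 χ₁ χ₂

end CharSeries

end

noncomputable section

namespace CharSeries

open Filter Topology Finset
open Complex (I integerComplement)

/-! Write s = 2πi/k, a = 2γ, a' = 2θ, so that aa' = -s². The n-th term of the first series is
χ₂(n)/n times `charLambert χ₁` at an.

Non-principal characters: the cotangent expansion writes `charLambert χ₁ w` as a limit of sums of
χ₁(m)(1/(w - sm) + χ₁(-1)/(w + sm)) (`tendsto_charPartial`). Since aa' = -s², the number an - sm is
a multiple of a'm + sn, and `reciprocal_identity` exchanges the roles of n and m at the cost of a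
pair with w = 0. Summing over n gives the terms of the second series, plus `charLambert χ₂ 0` times
∑ χ₁(m)/m. The latter is a product of two values at 0, which are P_1(0, G₁) and P_1(0, G₂). The
limit is taken under the sum over n by dominated convergence; the majorant
(`exists_norm_charPartial_le`) comes from the vanishing of ∑ χ₁ over a period.

Principal characters: Möbius inversion reduces both series to F(x) = ∑ 1/(n(e^(2nx) - 1)), and the
modularity of the discriminant gives F(x) - F(π²/x). Of the resulting double sum over divisors only
one logarithm survives, because ∑_{d ∣ k} μ(d) = 0 (`sum_moebius_lambertF`).

The evaluations modulo 6 and 3 are the case χ₁ = χ₂ odd, where `charLambert` has only two terms. -/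

/-! ### Partial fractions of the character sum -/

/-- The basic frequency `2πi/k`. -/
def freq (k : ℕ) : ℂ := 2 * (Real.pi : ℂ) * I / (k : ℂ)

/-- The character sum `∑_{v<k} χ(v) / (1 - e^(2πiv/k - w))`. -/
def charLambert {k : ℕ} (χ : DirichletCharacter ℂ k) (w : ℂ) : ℂ :=
  ∑ v ∈ range k, χ (v : ZMod k) / (1 - Complex.exp (freq k * v - w))

/-- A symmetric partial sum of the partial fraction expansion of `charLambert χ w`. -/
def charPartial {k : ℕ} (χ : DirichletCharacter ℂ k) (w : ℂ) (J : ℕ) : ℂ :=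
  ∑ m ∈ range (J * k),
    χ (m : ZMod k) * (1 / (w - freq k * m) + χ (-1) / (w + freq k * m))

theorem seriesTerm_eq {k : ℕ} (χ₁ χ₂ : DirichletCharacter ℂ k) (γ : ℝ) (n : ℕ) :
    seriesTerm χ₁ χ₂ γ n = χ₂ (n : ZMod k) / n * charLambert χ₁ (2 * n * γ) := by
  rw [seriesTerm, charLambert, mul_sum]
  refine sum_congr rfl fun v _ => ?_
  rw [freq, div_mul_div_comm, mul_comm (χ₁ _), mul_div_right_comm _ (v : ℂ)]

theorem sum_range_mul_blocks {M : Type*} [AddCommMonoid M] (f : ℕ → M) (k J : ℕ) :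
    ∑ m ∈ range (J * k), f m = ∑ j ∈ range J, ∑ v ∈ range k, f (v + j * k) := by
  induction J with
  | zero => simp
  | succ J ih =>
    rw [sum_range_succ, ← ih, Nat.succ_mul, sum_range_add]
    simp [add_comm]

theorem sum_range_reverse {M : Type*} [AddCommMonoid M] (f : ℕ → M) (N : ℕ) (h0 : f 0 = 0)
    (hN : f N = 0) : ∑ m ∈ range N, f m = ∑ m ∈ range N, f (N - m) := by
  have h1 : ∑ m ∈ range N, f m = ∑ m ∈ range N, f (m + 1) := by
    have := sum_range_succ f N
    rw [sum_range_succ', h0, hN, add_zero, add_zero] at this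
    exact this.symm
  rw [h1, ← sum_range_reflect]
  refine sum_congr rfl fun m hm => ?_
  rw [mem_range] at hm
  congr 1
  omega

section

variable {k : ℕ} (hk : 2 ≤ k) (χ : DirichletCharacter ℂ k)
include hk

theorem char_zero : χ (0 : ZMod k) = 0 := by
  have : Fact (1 < k) := ⟨hk⟩
  exact χ.map_nonunit (by simp)

/-- The reflection m ↦ Jk - m absorbs χ(-1) and moves the poles -sm onto the residue class of v, so
each class v carries its own symmetric cotangent sum. -/
theorem charPartial_eq_blocks (w : ℂ) (J : ℕ) :
    charPartial χ w J = ∑ j ∈ range J, ∑ v ∈ range k, χ (v : ZMod k) *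
      (1 / (w - freq k * (v + j * k)) + 1 / (w - freq k * (v - (j + 1) * k))) := by
  have h0 := char_zero hk χ
  have key : ∑ m ∈ range (J * k), χ (m : ZMod k) * (χ (-1) / (w + freq k * m)) =
      ∑ m ∈ range (J * k), χ (m : ZMod k) * (1 / (w - freq k * (m - J * k))) := by
    rw [sum_range_reverse _ _ (by simp [h0]) (by simp [h0])]
    refine sum_congr rfl fun m hm => ?_
    have hm' : m ≤ J * k := (mem_range.1 hm).le
    have e : ((J * k - m : ℕ) : ZMod k) = - (m : ZMod k) := by
      rw [Nat.cast_sub hm']; simp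
    rw [e, Nat.cast_sub hm', ← neg_one_mul, map_mul]
    have e2 : χ (-1) * χ (-1) = 1 := by
      rw [← map_mul]; simp
    have e3 : w + freq k * (((J * k : ℕ) : ℂ) - m) = w - freq k * (m - J * k) := by
      push_cast; ring
    rw [e3]
    linear_combination (χ (m : ZMod k) * (w - freq k * (m - J * k))⁻¹) * e2
  simp_rw [charPartial, mul_add, sum_add_distrib, key, sum_range_mul_blocks]
  congr 1
  · refine sum_congr rfl fun j _ => sum_congr rfl fun v _ => ?_
    simp [mul_add]
  · rw [← sum_range_reflect]
    refine sum_congr rfl fun j hj => sum_congr rfl fun v _ => ?_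
    have hj' : j + 1 ≤ J := mem_range.1 hj
    rw [show J - 1 - j = J - (j + 1) by omega]
    push_cast [Nat.cast_sub hj']
    simp only [CharP.cast_eq_zero, mul_zero, add_zero]
    rw [show (v : ℂ) + (J - (j + 1)) * k - J * k = v - (j + 1) * k by ring]

-- Pairing x + j with x - (j + 1) instead of x - j changes the usual partial sums by 1/x - 1/(x +
-- J), and the second term tends to 0.
omit hk in
theorem tendsto_cot_symm {x : ℂ} (hx : x ∈ integerComplement) :
    Tendsto (fun J : ℕ => ∑ j ∈ range J, (1 / (x + j) + 1 / (x - (j + 1)))) atTop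
      (𝓝 (Real.pi * Complex.cot (Real.pi * x))) := by
  have h1 := tendsto_logDeriv_euler_cot_sub hx
  have h2 : Tendsto (fun J : ℕ => 1 / (x + J)) atTop (𝓝 0) := by
    simp_rw [one_div]
    exact tendsto_inv₀_cobounded.comp
      ((tendsto_const_add_cobounded x).comp tendsto_natCast_atTop_cobounded)
  have h3 := (h1.add_const (1 / x)).sub h2
  rw [sub_zero, sub_add_cancel] at h3
  refine h3.congr fun J => ?_
  induction J with
  | zero => simp
  | succ J ih =>
    rw [sum_range_succ, sum_range_succ, ← ih, cotTerm]
    push_cast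
    ring

omit hk in
theorem one_div_one_sub_exp {x : ℂ} (hx : x ∈ integerComplement) :
    1 / (1 - Complex.exp (2 * Real.pi * I * x)) =
      1 / 2 - 1 / (2 * Real.pi * I) * (Real.pi * Complex.cot (Real.pi * x)) := by
  have hne : 1 - Complex.exp (2 * Real.pi * I * x) ≠ 0 := by
    intro h
    have h' : Complex.exp (2 * Real.pi * I * x) = 1 := (sub_eq_zero.1 h).symm
    obtain ⟨n, hn⟩ := Complex.exp_eq_one_iff.1 h'
    refine hx ⟨n, ?_⟩
    have : (2 * Real.pi * I : ℂ) ≠ 0 := Complex.two_pi_I_ne_zero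
    apply mul_left_cancel₀ this
    rw [hn]; ring
  have hpi : (Real.pi : ℂ) ≠ 0 := by exact_mod_cast Real.pi_ne_zero
  have hI := Complex.I_ne_zero
  rw [Complex.cot_pi_eq_exp_ratio]
  field_simp
  rw [Complex.I_sq]
  ring

/-- Regularity is asked only where χ(v) ≠ 0; this admits w = 0, where the class v = 0 would have a
pole. -/
theorem tendsto_charPartial {w : ℂ} (hw : ∀ v < k, χ (v : ZMod k) ≠ 0 →
      (v / k - w / (2 * Real.pi * I) : ℂ) ∈ integerComplement) :
    Tendsto (charPartial χ w) atTop
      (𝓝 (charLambert χ w - 1 / 2 * ∑ v ∈ range k, χ (v : ZMod k))) := by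
  have hk0 : (k : ℂ) ≠ 0 := by exact_mod_cast (by omega : k ≠ 0)
  have h2 : (2 * Real.pi * I : ℂ) ≠ 0 := Complex.two_pi_I_ne_zero
  have e : charLambert χ w - 1 / 2 * ∑ v ∈ range k, χ (v : ZMod k) =
      ∑ v ∈ range k, χ (v : ZMod k) * (-1 / (2 * Real.pi * I) *
        (Real.pi * Complex.cot (Real.pi * (v / k - w / (2 * Real.pi * I))))) := by
    rw [charLambert, mul_sum, ← sum_sub_distrib]
    refine sum_congr rfl fun v hv => ?_
    by_cases hχ : χ (v : ZMod k) = 0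
    · simp [hχ]
    have := one_div_one_sub_exp (hw v (mem_range.1 hv) hχ)
    rw [show 2 * Real.pi * I * (v / k - w / (2 * Real.pi * I) : ℂ) = freq k * v - w by
      rw [freq]; field_simp] at this
    rw [div_eq_mul_one_div, this]
    ring
  rw [e]
  have hT := tendsto_finsetSum (range k) fun v hv =>
    (show Tendsto (fun J : ℕ => χ (v : ZMod k) * (-1 / (2 * Real.pi * I) *
      ∑ j ∈ range J, (1 / ((v / k - w / (2 * Real.pi * I) : ℂ) + j) +
        1 / ((v / k - w / (2 * Real.pi * I) : ℂ) - (j + 1))))) atTop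
      (𝓝 (χ (v : ZMod k) * (-1 / (2 * Real.pi * I) *
        (Real.pi * Complex.cot (Real.pi * (v / k - w / (2 * Real.pi * I))))))) from by
      by_cases hχ : χ (v : ZMod k) = 0
      · simp [hχ]
      exact ((tendsto_cot_symm (hw v (mem_range.1 hv) hχ)).const_mul _).const_mul _)
  refine hT.congr fun J => ?_
  rw [charPartial_eq_blocks hk, sum_comm]
  refine sum_congr rfl fun v _ => ?_
  rw [mul_sum, mul_sum]
  refine sum_congr rfl fun j _ => ?_
  have aux : ∀ y z : ℂ, y = -1 * (2 * Real.pi * I) * z →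
      -1 / (2 * Real.pi * I) * (1 / z) = 1 / y := by
    rintro y z rfl
    rw [div_mul_div_comm, ← div_div, ← neg_one_mul]
    by_cases hz : z = 0
    · simp [hz]
    field_simp
  rw [mul_add (-1 / (2 * Real.pi * I : ℂ)), aux (w - freq k * (v + j * k)),
    aux (w - freq k * (v - (j + 1) * k))]
  · rw [freq]; field_simp; ring
  · rw [freq]; field_simp; ring

omit hk in
theorem sum_eq_zero_of_ne_one [NeZero k] (hχ : χ ≠ 1) : ∑ v ∈ range k, χ (v : ZMod k) = 0 := by
  rw [← MulChar.sum_eq_zero_of_ne_one hχ]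
  refine sum_nbij' (fun v => (v : ZMod k)) ZMod.val (by simp) ?_ ?_ (by simp) (by simp)
  · intro a _
    exact mem_range.2 a.val_lt
  · intro v hv
    exact ZMod.val_cast_of_lt (mem_range.1 hv)

end

/-! ### A bound for the partial sums, uniform in their length -/

theorem norm_sub_freq_mul_ge (k : ℕ) (t x : ℝ) :
    |t| ≤ ‖(t : ℂ) - freq k * x‖ ∧ 2 * Real.pi * |x| / k ≤ ‖(t : ℂ) - freq k * x‖ := by
  have e : (t : ℂ) - freq k * x = (t : ℝ) + (-(2 * Real.pi * x / k) : ℝ) * I := by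
    rw [freq]; push_cast; ring
  constructor
  · refine le_of_eq_of_le ?_ (Complex.abs_re_le_norm _)
    rw [e]; simp
  · refine le_of_eq_of_le ?_ (Complex.abs_im_le_norm _)
    rw [e, Complex.add_im, Complex.ofReal_im, Complex.im_ofReal_mul, Complex.I_im, mul_one,
      zero_add, abs_neg, abs_div, abs_mul, Nat.abs_cast, abs_of_pos Real.two_pi_pos]

theorem norm_one_div_sub_one_div_le {k : ℕ} {t x y M : ℝ} (hk : 0 < k) (hM : 0 < M)
    (hx : M ≤ ‖(t : ℂ) - freq k * x‖) (hy : M ≤ ‖(t : ℂ) - freq k * y‖) (hxy : |x - y| ≤ k) :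
    ‖1 / ((t : ℂ) - freq k * x) - 1 / ((t : ℂ) - freq k * y)‖ ≤ 2 * Real.pi / M ^ 2 := by
  have hx0 : (t : ℂ) - freq k * x ≠ 0 := norm_pos_iff.1 (hM.trans_le hx)
  have hy0 : (t : ℂ) - freq k * y ≠ 0 := norm_pos_iff.1 (hM.trans_le hy)
  have e : 1 / ((t : ℂ) - freq k * x) - 1 / ((t : ℂ) - freq k * y) =
      freq k * ((x - y : ℝ) : ℂ) / (((t : ℂ) - freq k * x) * ((t : ℂ) - freq k * y)) := by
    push_cast
    field_simp
    ring
  have hk' : (0 : ℝ) < k := by exact_mod_cast hk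
  have hf : ‖freq k‖ = 2 * Real.pi / k := by
    simp [freq, abs_of_pos Real.pi_pos]
  rw [e, norm_div, norm_mul, norm_mul, hf, Complex.norm_real, Real.norm_eq_abs, pow_two]
  refine div_le_div₀ (by positivity) ?_ (by positivity) (mul_le_mul hx hy hM.le (norm_nonneg _))
  rw [div_mul_eq_mul_div, div_le_iff₀ hk']
  exact mul_le_mul_of_nonneg_left hxy (by positivity)

/-- Cancellation of χ over a period makes the j-th block O(1/M²) with M = max(t, 2πj). Splitting M⁻²
into exponents 1/2 and 3/2 leaves a convergent sum over j and enough decay in t for ∑ t^(-1/2)/n to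
converge when t is proportional to n. -/
theorem exists_norm_charPartial_le {k : ℕ} (hk : 2 ≤ k) {χ : DirichletCharacter ℂ k}
    (hχ : χ ≠ 1) {t₀ : ℝ} (ht₀ : 0 < t₀) :
    ∃ C : ℝ, ∀ t : ℝ, t₀ ≤ t → ∀ J, ‖charPartial χ t J‖ ≤ C * t ^ (-(1 / 2) : ℝ) := by
  have hk0 : 0 < k := by omega
  have : NeZero k := ⟨hk0.ne'⟩
  have hkR : (0 : ℝ) < k := by exact_mod_cast hk0
  have hpi := Real.pi_gt_three
  set c := min t₀ 1 with hc
  have hc0 : 0 < c := lt_min ht₀ one_pos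
  have hsum : Summable fun j : ℕ => ((j + 1 : ℕ) : ℝ) ^ (-(3 / 2) : ℝ) :=
    (summable_nat_add_iff 1).2 (Real.summable_nat_rpow.2 (by norm_num))
  refine ⟨k * (4 * Real.pi) * c ^ (-(3 / 2) : ℝ) * ∑' j : ℕ, ((j + 1 : ℕ) : ℝ) ^ (-(3 / 2) : ℝ),
    fun t ht J => ?_⟩
  have ht0 : 0 < t := ht₀.trans_le ht
  have hblock : ∀ j : ℕ, ‖∑ v ∈ range k, χ (v : ZMod k) *
      (1 / ((t : ℂ) - freq k * (v + j * k)) + 1 / ((t : ℂ) - freq k * (v - (j + 1) * k)))‖ ≤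
      k * (4 * Real.pi) * c ^ (-(3 / 2) : ℝ) * t ^ (-(1 / 2) : ℝ) *
        ((j + 1 : ℕ) : ℝ) ^ (-(3 / 2) : ℝ) := by
    intro j
    set M := max t (2 * Real.pi * j) with hM
    have hMt : t ≤ M := le_max_left _ _
    have hM0 : 0 < M := ht0.trans_le hMt
    -- For j = 0 this rests on t ≥ t₀, for j ≥ 1 on 2πj ≥ j + 1; hence c = min(t₀, 1).
    have hMc : c * ((j + 1 : ℕ) : ℝ) ≤ M := by
      rcases Nat.eq_zero_or_pos j with rfl | hj
      · have h1 : c ≤ M := (min_le_left t₀ 1).trans (ht.trans hMt)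
        simpa using h1
      · have hj' : (1 : ℝ) ≤ j := by exact_mod_cast hj
        have h1 : c ≤ 1 := min_le_right _ _
        refine le_trans ?_ (le_max_right _ _)
        push_cast
        nlinarith
    have hnorm : ∀ x : ℝ, (j : ℝ) * k ≤ |x| → M ≤ ‖(t : ℂ) - freq k * x‖ := by
      intro x hx
      obtain ⟨h1, h2⟩ := norm_sub_freq_mul_ge k t x
      refine max_le ((le_abs_self t).trans h1) (le_trans ?_ h2)
      rw [le_div_iff₀ hkR]
      nlinarith
    have hMinv : 1 / M ^ 2 ≤ t ^ (-(1 / 2) : ℝ) *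
        (c ^ (-(3 / 2) : ℝ) * ((j + 1 : ℕ) : ℝ) ^ (-(3 / 2) : ℝ)) := by
      have e : 1 / M ^ 2 = M ^ (-(1 / 2) : ℝ) * M ^ (-(3 / 2) : ℝ) := by
        rw [← Real.rpow_add hM0, one_div, ← Real.rpow_natCast, ← Real.rpow_neg hM0.le]
        norm_num
      rw [e, ← Real.mul_rpow hc0.le (by positivity)]
      refine mul_le_mul (Real.rpow_le_rpow_of_nonpos ht0 hMt (by norm_num))
        (Real.rpow_le_rpow_of_nonpos (by positivity) hMc (by norm_num)) (by positivity)
        (by positivity)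
    -- Since ∑ χ(v) = 0, the values at the fixed points jk and -jk may be subtracted for free.
    have hsub : ∑ v ∈ range k, χ (v : ZMod k) *
        (1 / ((t : ℂ) - freq k * (v + j * k)) + 1 / ((t : ℂ) - freq k * (v - (j + 1) * k))) =
        ∑ v ∈ range k, χ (v : ZMod k) *
        ((1 / ((t : ℂ) - freq k * ((v + j * k : ℝ) : ℂ)) -
            1 / ((t : ℂ) - freq k * ((j * k : ℝ) : ℂ))) +
          (1 / ((t : ℂ) - freq k * ((v - (j + 1) * k : ℝ) : ℂ)) -
            1 / ((t : ℂ) - freq k * ((-(j * k) : ℝ) : ℂ)))) := by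
      have h0 := sum_eq_zero_of_ne_one χ hχ
      rw [← sub_eq_zero, ← sum_sub_distrib]
      rw [← mul_zero (1 / ((t : ℂ) - freq k * ((j * k : ℝ) : ℂ)) +
        1 / ((t : ℂ) - freq k * ((-(j * k) : ℝ) : ℂ))), ← h0, mul_sum]
      refine sum_congr rfl fun v _ => ?_
      push_cast
      ring
    rw [hsub]
    have hterm : ∀ v ∈ range k, ‖χ (v : ZMod k) *
        ((1 / ((t : ℂ) - freq k * ((v + j * k : ℝ) : ℂ)) -
            1 / ((t : ℂ) - freq k * ((j * k : ℝ) : ℂ))) +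
          (1 / ((t : ℂ) - freq k * ((v - (j + 1) * k : ℝ) : ℂ)) -
            1 / ((t : ℂ) - freq k * ((-(j * k) : ℝ) : ℂ))))‖ ≤ 4 * Real.pi * (1 / M ^ 2) := by
      intro v hv
      have hv' : (v : ℝ) ≤ k := by exact_mod_cast (mem_range.1 hv).le
      have hv0 : (0 : ℝ) ≤ v := v.cast_nonneg
      have hjk : (0 : ℝ) ≤ j * k := by positivity
      rw [norm_mul]
      refine (mul_le_of_le_one_left (norm_nonneg _) (χ.norm_le_one _)).trans ?_
      refine (norm_add_le _ _).trans ?_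
      have h1 := norm_one_div_sub_one_div_le (t := t) hk0 hM0
        (hnorm (v + j * k) (by rw [abs_of_nonneg] <;> linarith))
        (hnorm (j * k) (le_abs_self _)) (by rw [add_sub_cancel_right, abs_of_nonneg hv0]; exact hv')
      have h2 := norm_one_div_sub_one_div_le (t := t) hk0 hM0
        (hnorm (v - (j + 1) * k) (by rw [abs_of_nonpos] <;> linarith))
        (hnorm (-(j * k)) (by rw [abs_neg]; exact le_abs_self _))
        (by rw [abs_of_nonpos] <;> linarith)
      calc _ ≤ _ := add_le_add h1 h2
        _ = _ := by ring
    calc _ ≤ ∑ v ∈ range k, 4 * Real.pi * (1 / M ^ 2) := norm_sum_le_of_le _ hterm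
      _ = k * (4 * Real.pi) * (1 / M ^ 2) := by simp; ring
      _ ≤ k * (4 * Real.pi) * _ := mul_le_mul_of_nonneg_left hMinv (by positivity)
      _ = _ := by ring
  rw [charPartial_eq_blocks hk]
  refine (norm_sum_le_of_le _ fun j _ => hblock j).trans ?_
  rw [← mul_sum]
  have := hsum.sum_le_tsum (range J) fun j _ => by positivity
  calc _ ≤ k * (4 * Real.pi) * c ^ (-(3 / 2) : ℝ) * t ^ (-(1 / 2) : ℝ) *
        ∑' j : ℕ, ((j + 1 : ℕ) : ℝ) ^ (-(3 / 2) : ℝ) :=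
        mul_le_mul_of_nonneg_left this (by positivity)
    _ = _ := by ring

theorem mem_integerComplement_of_pos (k v : ℕ) {t : ℝ} (ht : 0 < t) :
    (v / k - t / (2 * Real.pi * I) : ℂ) ∈ integerComplement := by
  rintro ⟨n, hn⟩
  have e : (v / k - t / (2 * Real.pi * I) : ℂ) = ((v / k : ℝ) : ℂ) + (t / (2 * Real.pi) : ℝ) * I := by
    push_cast
    have := Complex.I_ne_zero
    have hpi : (Real.pi : ℂ) ≠ 0 := by exact_mod_cast Real.pi_ne_zero
    field_simp
    linear_combination (-(t : ℂ)) * Complex.I_sq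
  have h := congrArg Complex.im hn
  rw [e] at h
  simp only [Complex.intCast_im, Complex.add_im, Complex.ofReal_im, Complex.im_ofReal_mul,
    Complex.I_im, mul_one, zero_add] at h
  have : 0 < t / (2 * Real.pi) := by positivity
  linarith

theorem mem_integerComplement_of_lt {k v : ℕ} (hv : 0 < v) (hvk : v < k) :
    (v / k : ℂ) ∈ integerComplement := by
  rintro ⟨n, hn⟩
  have hk0 : (k : ℂ) ≠ 0 := by exact_mod_cast (by omega : k ≠ 0)
  rw [eq_div_iff hk0] at hn
  have h : n * (k : ℤ) = v := by exact_mod_cast hn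
  have h1 : (0 : ℤ) < n := by
    by_contra hc
    nlinarith
  nlinarith

section

variable {k : ℕ} (hk : 2 ≤ k) (χ : DirichletCharacter ℂ k)
include hk

theorem mem_integerComplement_of_char_ne_zero (v : ℕ) (hv : v < k) (hχ : χ (v : ZMod k) ≠ 0) :
    (v / k : ℂ) ∈ integerComplement := by
  refine mem_integerComplement_of_lt (Nat.pos_of_ne_zero fun h => hχ ?_) hv
  rw [h, Nat.cast_zero, char_zero hk]

theorem one_sub_exp_freq_ne_zero (v : ℕ) (hv : v < k) (hχ : χ (v : ZMod k) ≠ 0) :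
    1 - Complex.exp (freq k * v) ≠ 0 := by
  intro h
  obtain ⟨n, hn⟩ := Complex.exp_eq_one_iff.1 (sub_eq_zero.1 h).symm
  refine mem_integerComplement_of_char_ne_zero hk χ v hv hχ ⟨n, ?_⟩
  apply mul_left_cancel₀ Complex.two_pi_I_ne_zero
  rw [mul_comm _ (n : ℂ), ← hn, freq]
  ring

theorem tendsto_charPartial_of_pos (hχ : χ ≠ 1) {t : ℝ} (ht : 0 < t) :
    Tendsto (charPartial χ t) atTop (𝓝 (charLambert χ t)) := by
  have : NeZero k := ⟨by omega⟩
  have h := tendsto_charPartial hk χ (w := t) fun v _ _ => mem_integerComplement_of_pos k v ht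
  rwa [sum_eq_zero_of_ne_one χ hχ, mul_zero, sub_zero] at h

theorem tendsto_charPartial_zero (hχ : χ ≠ 1) :
    Tendsto (charPartial χ 0) atTop (𝓝 (charLambert χ 0)) := by
  have : NeZero k := ⟨by omega⟩
  have h := tendsto_charPartial hk χ (w := 0) fun v hv hχ => by
    rw [zero_div, sub_zero]
    exact mem_integerComplement_of_char_ne_zero hk χ v hv hχ
  rwa [sum_eq_zero_of_ne_one χ hχ, mul_zero, sub_zero] at h

/-! ### The value at w = 0 and P_1(0, G(χ)) -/

omit hk in
theorem sum_range_natCast_mul_pow (z : ℂ) (n : ℕ) :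
    (∑ m ∈ range n, z ^ m * m) * (z - 1) = n * z ^ n - z * ∑ m ∈ range n, z ^ m := by
  induction n with
  | zero => simp
  | succ n ih =>
    rw [sum_range_succ, sum_range_succ, add_mul, ih]
    push_cast
    ring

omit hk in
theorem bernoulliP_one_div {m : ℕ} (hm : m < k) :
    bernoulliP 1 (((m : ℝ) + 0) / k) = m / k - 1 / 2 := by
  have hk0 : (0 : ℝ) < k := by exact_mod_cast (by omega : 0 < k)
  have h : Int.fract (((m : ℝ) + 0) / k) = m / k := by
    rw [add_zero, Int.fract_eq_self]
    refine ⟨by positivity, ?_⟩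
    rw [div_lt_one hk0]
    exact_mod_cast hm
  rw [bernoulliP, h, bernoulliFun_one]
  simp

/-- The value `P_1(0, G(χ))` in terms of the character sum at `0`. -/
theorem periodicBernoulliP_charGauss :
    periodicBernoulliP k 1 0 (charGauss χ) =
      charLambert χ 0 - ∑ v ∈ range k, χ (v : ZMod k) := by
  have hk0 : (k : ℂ) ≠ 0 := by exact_mod_cast (by omega : k ≠ 0)
  have h1 : periodicBernoulliP k 1 0 (charGauss χ) = ∑ v ∈ range k, χ (v : ZMod k) *
      ∑ m ∈ range k, Complex.exp (-(freq k * v)) ^ m * ((m : ℂ) / k - 1 / 2) := by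
    simp_rw [mul_sum]
    rw [sum_comm, periodicBernoulliP, pow_zero, one_mul]
    refine sum_congr rfl fun m hm => ?_
    rw [zero_add, bernoulliP_one_div (mem_range.1 hm), charGauss, sum_mul]
    refine sum_congr rfl fun v _ => ?_
    rw [← Complex.exp_nat_mul, mul_assoc]
    congr 2
    · congr 1
      rw [freq]
      push_cast
      ring
    · push_cast
      ring
  rw [h1, charLambert, ← sum_sub_distrib]
  refine sum_congr rfl fun v hv => ?_
  by_cases hχ : χ (v : ZMod k) = 0
  · simp [hχ]
  set E := Complex.exp (freq k * v) with hE
  have hE0 : E ≠ 0 := Complex.exp_ne_zero _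
  have hE1 : 1 - E ≠ 0 := one_sub_exp_freq_ne_zero hk χ v (mem_range.1 hv) hχ
  have hEk : (E⁻¹) ^ k = 1 := by
    rw [hE, ← Complex.exp_neg, ← Complex.exp_nat_mul, freq]
    rw [show (k : ℂ) * -(2 * Real.pi * I / k * v) = ((-(v : ℤ) : ℤ) : ℂ) * (2 * Real.pi * I) by
      push_cast; field_simp]
    exact Complex.exp_int_mul_two_pi_mul_I _
  have hz : E⁻¹ - 1 ≠ 0 := by
    intro h
    apply hE1
    rw [sub_eq_zero] at h
    rw [inv_eq_one.1 h, sub_self]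
  have hg : ∑ m ∈ range k, E⁻¹ ^ m = 0 := by
    have := geom_sum_mul E⁻¹ k
    rw [hEk, sub_self] at this
    exact (mul_eq_zero.1 this).resolve_right hz
  have hg2 : ∑ m ∈ range k, E⁻¹ ^ m * m = k / (E⁻¹ - 1) := by
    have := sum_range_natCast_mul_pow E⁻¹ k
    rw [hEk, hg, mul_zero, sub_zero, mul_one] at this
    rw [eq_div_iff hz, this]
  -- E⁻¹ is a k-th root of unity other than 1. The result E/(1 - E) = 1/(1 - E) - 1 accounts for the
  -- subtracted sum of χ.
  have e : ∑ m ∈ range k, E⁻¹ ^ m * ((m : ℂ) / k - 1 / 2) = E / (1 - E) := by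
    calc _ = (∑ m ∈ range k, E⁻¹ ^ m * m) / k - (∑ m ∈ range k, E⁻¹ ^ m) / 2 := by
          rw [sum_div, sum_div, ← sum_sub_distrib]
          refine sum_congr rfl fun m _ => ?_
          ring
      _ = _ := by
          rw [hg, hg2]
          have : E⁻¹ - 1 = (1 - E) / E := by field_simp
          rw [this]
          field_simp
          ring
  rw [Complex.exp_neg, ← hE, e, sub_zero, ← hE]
  field_simp
  ring

end

/-! ### Reciprocity for non-principal characters -/

/-- By aa' = -s², an - sm = -(s/a')(a'm + sn) and an + sm = (s/a')(a'm - sn); partial fractions then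
trade 1/n for 1/m. The form `0 - s * n` matches `charPartial` at w = 0. -/
theorem reciprocal_identity {s a a' ε n m : ℂ} (hs : s ≠ 0) (ha' : a' ≠ 0)
    (h : a * a' = -s ^ 2) (hε : ε ^ 2 = 1) (hn : n ≠ 0) (hm : m ≠ 0)
    (h1 : a' * m - s * n ≠ 0) (h2 : a' * m + s * n ≠ 0) :
    1 / n * (1 / (a * n - s * m) + ε / (a * n + s * m)) =
      1 / m * (ε * (1 / (a' * m - s * n) + ε / (a' * m + s * n)) +
        (1 / (0 - s * n) + ε / (0 + s * n))) := by
  have e1 : a * n - s * m = -(s / a') * (a' * m + s * n) := by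
    field_simp
    linear_combination n * h
  have e2 : a * n + s * m = (s / a') * (a' * m - s * n) := by
    field_simp
    linear_combination n * h
  rw [e1, e2]
  have h1' : a' * m - n * s ≠ 0 := by rwa [mul_comm n s]
  have h2' : a' * m + n * s ≠ 0 := by rwa [mul_comm n s]
  have p1 : 1 / n * (1 / (-(s / a') * (a' * m + s * n))) =
      1 / m * (1 / (a' * m + s * n) + 1 / (0 - s * n)) := by
    rw [zero_sub]
    field_simp
    ring
  have p2 : 1 / n * (1 / ((s / a') * (a' * m - s * n))) =
      1 / m * (1 / (a' * m - s * n) + 1 / (0 + s * n)) := by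
    rw [zero_add]
    field_simp
    ring
  linear_combination p1 + ε * p2 - (1 / m * (1 / (a' * m + s * n))) * hε

theorem freq_ne_zero {k : ℕ} (hk : 2 ≤ k) : freq k ≠ 0 := by
  have hk0 : (k : ℂ) ≠ 0 := by exact_mod_cast (by omega : k ≠ 0)
  exact div_ne_zero Complex.two_pi_I_ne_zero hk0

theorem sub_freq_mul_ne_zero (k : ℕ) {t : ℝ} (ht : 0 < t) (x : ℝ) : (t : ℂ) - freq k * x ≠ 0 :=
  norm_pos_iff.1 ((abs_pos.2 ht.ne').trans_le (norm_sub_freq_mul_ge k t x).1)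

theorem char_neg_one_sq {k : ℕ} (χ : DirichletCharacter ℂ k) : χ (-1) ^ 2 = 1 := by
  rw [← map_pow]
  simp

section

variable {k : ℕ} (hk : 2 ≤ k) {χ₁ χ₂ : DirichletCharacter ℂ k}
include hk

omit hk in
theorem norm_pair_le (χ : DirichletCharacter ℂ k) {t : ℝ} (ht : 0 < t) (m : ℕ) :
    ‖1 / ((t : ℂ) - freq k * m) + χ (-1) / (t + freq k * m)‖ ≤ 2 / t := by
  have h1 := (norm_sub_freq_mul_ge k t m).1
  have h2 := (norm_sub_freq_mul_ge k t (-m)).1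
  rw [abs_of_pos ht] at h1 h2
  push_cast at h1 h2
  rw [mul_neg, sub_neg_eq_add] at h2
  refine (norm_add_le _ _).trans ?_
  rw [norm_div, norm_div, norm_one]
  have h3 : 1 / ‖(t : ℂ) - freq k * m‖ ≤ 1 / t := one_div_le_one_div_of_le ht h1
  have h4 : ‖χ (-1)‖ / ‖(t : ℂ) + freq k * m‖ ≤ 1 / t :=
    div_le_div₀ zero_le_one (χ.norm_le_one _) ht h2
  calc _ ≤ 1 / t + 1 / t := add_le_add h3 h4
    _ = _ := by ring

omit hk in
theorem summable_char_pair (χ χ' : DirichletCharacter ℂ k) {a : ℝ} (ha : 0 < a) (m : ℕ) :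
    Summable fun n : ℕ => χ (n : ZMod k) / n *
      (1 / (((a * n : ℝ) : ℂ) - freq k * m) + χ' (-1) / (((a * n : ℝ) : ℂ) + freq k * m)) := by
  refine Summable.of_norm_bounded (g := fun n : ℕ => 2 / a * (1 / (n : ℝ) ^ 2))
    ((Real.summable_one_div_nat_pow.2 one_lt_two).mul_left _) fun n => ?_
  rcases Nat.eq_zero_or_pos n with rfl | hn
  · simp
  have hn' : (0 : ℝ) < n := by exact_mod_cast hn
  rw [norm_mul, norm_div, Complex.norm_natCast]
  calc _ ≤ 1 / (n : ℝ) * (2 / (a * n)) :=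
        mul_le_mul (div_le_div_of_nonneg_right (χ.norm_le_one _) hn'.le)
          (norm_pair_le χ' (by positivity) m) (norm_nonneg _) (by positivity)
    _ = _ := by field_simp

/-- At w = 0 each pair has the factor χ(-1) - 1, killed by 1 + χ(-1). So the value at 0 vanishes for
even χ, and both parities can be treated together. -/
theorem one_add_mul_charLambert_zero {χ : DirichletCharacter ℂ k} (hχ : χ ≠ 1) :
    (1 + χ (-1)) * charLambert χ 0 = 0 := by
  refine tendsto_nhds_unique ((tendsto_charPartial_zero hk χ hχ).const_mul (1 + χ (-1))) ?_
  refine tendsto_const_nhds.congr fun J => ?_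
  rw [charPartial, mul_sum]
  refine (sum_eq_zero fun m _ => ?_).symm
  rw [zero_sub, zero_add, div_neg]
  linear_combination χ (m : ZMod k) * (1 / (freq k * m)) * char_neg_one_sq χ

/-- Expresses the sums of χ(m)/m through the value at 0; for even χ both sides vanish, so no
convergence of ∑ χ(m)/m is needed. -/
theorem charPartial_zero_eq (χ : DirichletCharacter ℂ k) (J : ℕ) :
    freq k * charPartial χ 0 J = -(1 - χ (-1)) * ∑ m ∈ range (J * k), χ (m : ZMod k) / m := by
  have hs := freq_ne_zero hk
  rw [charPartial, mul_sum, mul_sum]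
  refine sum_congr rfl fun m _ => ?_
  rw [zero_sub, zero_add, div_neg]
  by_cases hm : (m : ℂ) = 0
  · simp [hm]
  field_simp
  ring

theorem exists_norm_series_le (χ : DirichletCharacter ℂ k) {χ' : DirichletCharacter ℂ k}
    (hχ' : χ' ≠ 1) {a : ℝ} (ha : 0 < a) :
    ∃ C : ℝ, ∀ n J : ℕ, ‖χ (n : ZMod k) / n * charPartial χ' ((a * n : ℝ) : ℂ) J‖ ≤
      C * (n : ℝ) ^ (-(3 / 2) : ℝ) := by
  obtain ⟨C, hC⟩ := exists_norm_charPartial_le hk hχ' ha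
  have hC0 : 0 ≤ C := by
    have := (norm_nonneg _).trans (hC a le_rfl 0)
    exact nonneg_of_mul_nonneg_left this (by positivity)
  refine ⟨C * a ^ (-(1 / 2) : ℝ), fun n J => ?_⟩
  rcases Nat.eq_zero_or_pos n with rfl | hn
  · simp only [Nat.cast_zero, div_zero, zero_mul, norm_zero]
    positivity
  have hn' : (1 : ℝ) ≤ n := by exact_mod_cast hn
  have hn0 : (0 : ℝ) < n := by linarith
  rw [norm_mul, norm_div, Complex.norm_natCast]
  calc _ ≤ 1 / (n : ℝ) * (C * (a * n) ^ (-(1 / 2) : ℝ)) :=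
        mul_le_mul (div_le_div_of_nonneg_right (χ.norm_le_one _) hn0.le)
          (hC _ (by nlinarith) J) (norm_nonneg _) (by positivity)
    _ = _ := by
        rw [Real.mul_rpow ha.le hn0.le, one_div, ← Real.rpow_neg_one,
          show (-(3 / 2) : ℝ) = -1 + -(1 / 2) by norm_num, Real.rpow_add hn0]
        ring

theorem summable_series (χ : DirichletCharacter ℂ k) {χ' : DirichletCharacter ℂ k}
    (hχ' : χ' ≠ 1) {a : ℝ} (ha : 0 < a) :
    Summable fun n : ℕ => χ (n : ZMod k) / n * charLambert χ' ((a * n : ℝ) : ℂ) := by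
  obtain ⟨C, hC⟩ := exists_norm_series_le hk χ hχ' ha
  refine Summable.of_norm_bounded (g := fun n : ℕ => C * (n : ℝ) ^ (-(3 / 2) : ℝ))
    ((Real.summable_nat_rpow.2 (by norm_num)).mul_left _) fun n => ?_
  rcases Nat.eq_zero_or_pos n with rfl | hn
  · simp
  have hn' : (0 : ℝ) < n := by exact_mod_cast hn
  exact le_of_tendsto
    ((tendsto_charPartial_of_pos hk χ' hχ' (by positivity : 0 < a * n)).const_mul _).norm
    (Eventually.of_forall fun J => hC n J)

theorem tendsto_tsum_charPartial (χ : DirichletCharacter ℂ k) {χ' : DirichletCharacter ℂ k}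
    (hχ' : χ' ≠ 1) {a : ℝ} (ha : 0 < a) :
    Tendsto (fun J => ∑' n : ℕ, χ (n : ZMod k) / n * charPartial χ' ((a * n : ℝ) : ℂ) J) atTop
      (𝓝 (∑' n : ℕ, χ (n : ZMod k) / n * charLambert χ' ((a * n : ℝ) : ℂ))) := by
  obtain ⟨C, hC⟩ := exists_norm_series_le hk χ hχ' ha
  refine tendsto_tsum_of_dominated_convergence (bound := fun n : ℕ => C * (n : ℝ) ^ (-(3 / 2) : ℝ))
    ((Real.summable_nat_rpow.2 (by norm_num)).mul_left _) (fun n => ?_)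
    (Eventually.of_forall fun J n => hC n J)
  rcases Nat.eq_zero_or_pos n with rfl | hn
  · simp
  have hn' : (0 : ℝ) < n := by exact_mod_cast hn
  exact (tendsto_charPartial_of_pos hk χ' hχ' (by positivity : 0 < a * n)).const_mul _

/-- The reciprocity relation for one partial fraction. -/
theorem tsum_char_pair (hχ₂ : χ₂ ≠ 1) (hε : χ₁ (-1) = χ₂ (-1)) {a a' : ℝ} (ha : 0 < a)
    (ha' : 0 < a') (haa : (a : ℂ) * a' = -freq k ^ 2) {m : ℕ} (hm : 0 < m) :
    ∑' n : ℕ, χ₂ (n : ZMod k) / n *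
      (1 / (((a * n : ℝ) : ℂ) - freq k * m) + χ₁ (-1) / (((a * n : ℝ) : ℂ) + freq k * m)) =
    1 / m * (χ₂ (-1) * charLambert χ₂ ((a' * m : ℝ) : ℂ) + charLambert χ₂ 0) := by
  have hm' : (0 : ℝ) < m := by exact_mod_cast hm
  have hJ : Tendsto (fun J : ℕ => J * k) atTop atTop :=
    tendsto_id.atTop_mul_const' (by omega)
  -- Along the partial sums n < Jk the reciprocal identity turns the left side into `charPartial χ₂`
  -- at a'm and at 0.
  refine tendsto_nhds_unique
    ((summable_char_pair χ₂ χ₁ ha m).hasSum.tendsto_sum_nat.comp hJ) ?_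
  refine ((((tendsto_charPartial_of_pos hk χ₂ hχ₂ (by positivity : 0 < a' * m)).const_mul
    (χ₂ (-1))).add (tendsto_charPartial_zero hk χ₂ hχ₂)).const_mul (1 / (m : ℂ))).congr fun J => ?_
  simp only [Function.comp]
  rw [charPartial, charPartial, mul_sum, ← sum_add_distrib, mul_sum]
  refine sum_congr rfl fun n _ => ?_
  rcases Nat.eq_zero_or_pos n with rfl | hn
  · simp [char_zero hk]
  have h1 := sub_freq_mul_ne_zero k (by positivity : 0 < a' * m) n
  have h2 := sub_freq_mul_ne_zero k (by positivity : 0 < a' * m) (-n)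
  push_cast at h1 h2 ⊢
  rw [mul_neg, sub_neg_eq_add] at h2
  have := reciprocal_identity (freq_ne_zero hk) (by exact_mod_cast ha'.ne') haa
    (char_neg_one_sq χ₂) (by exact_mod_cast hn.ne' : (n : ℂ) ≠ 0)
    (by exact_mod_cast hm.ne' : (m : ℂ) ≠ 0) h1 h2
  rw [hε]
  linear_combination (-χ₂ (n : ZMod k)) * this

/-- Only finitely many m are exchanged with the series over n; then J → ∞ on both sides. -/
theorem series_reciprocity (hχ₁ : χ₁ ≠ 1) (hχ₂ : χ₂ ≠ 1) (hε : χ₁ (-1) = χ₂ (-1)) {a a' : ℝ}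
    (ha : 0 < a) (ha' : 0 < a') (haa : (a : ℂ) * a' = -freq k ^ 2) :
    (∑' n : ℕ, χ₂ (n : ZMod k) / n * charLambert χ₁ ((a * n : ℝ) : ℂ)) -
      χ₂ (-1) * ∑' n : ℕ, χ₁ (n : ZMod k) / n * charLambert χ₂ ((a' * n : ℝ) : ℂ) =
    freq k / 2 * χ₁ (-1) * charLambert χ₁ 0 * charLambert χ₂ 0 := by
  have hJ : Tendsto (fun J : ℕ => J * k) atTop atTop :=
    tendsto_id.atTop_mul_const' (by omega)
  have hz := one_add_mul_charLambert_zero hk hχ₂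
  rw [sub_eq_iff_eq_add]
  refine tendsto_nhds_unique (tendsto_tsum_charPartial hk χ₂ hχ₁ ha) ?_
  have hlim := (((tendsto_charPartial_zero hk χ₁ hχ₁).const_mul
    (-(freq k / 2) * charLambert χ₂ 0)).add
    (((summable_series hk χ₁ hχ₂ ha').hasSum.tendsto_sum_nat.comp hJ).const_mul (χ₂ (-1))))
  have e : -(freq k / 2) * charLambert χ₂ 0 * charLambert χ₁ 0 =
      freq k / 2 * χ₁ (-1) * charLambert χ₁ 0 * charLambert χ₂ 0 := by
    rw [hε]
    linear_combination (-(freq k / 2) * charLambert χ₁ 0) * hz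
  rw [e] at hlim
  refine hlim.congr fun J => ?_
  have hsum : ∑' n : ℕ, χ₂ (n : ZMod k) / n * charPartial χ₁ ((a * n : ℝ) : ℂ) J =
      ∑ m ∈ range (J * k), χ₁ (m : ZMod k) * ∑' n : ℕ, χ₂ (n : ZMod k) / n *
        (1 / (((a * n : ℝ) : ℂ) - freq k * m) + χ₁ (-1) / (((a * n : ℝ) : ℂ) + freq k * m)) := by
    simp_rw [← tsum_mul_left]
    rw [← Summable.tsum_finsetSum fun m _ => (summable_char_pair χ₂ χ₁ ha m).mul_left _]
    refine tsum_congr fun n => ?_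
    rw [charPartial, mul_sum]
    refine sum_congr rfl fun m _ => ?_
    ring
  have hsum' : ∑' n : ℕ, χ₂ (n : ZMod k) / n * charPartial χ₁ ((a * n : ℝ) : ℂ) J =
      ∑ m ∈ range (J * k), (χ₂ (-1) * (χ₁ (m : ZMod k) / m * charLambert χ₂ ((a' * m : ℝ) : ℂ)) +
        charLambert χ₂ 0 * (χ₁ (m : ZMod k) / m)) := by
    rw [hsum]
    refine sum_congr rfl fun m _ => ?_
    rcases Nat.eq_zero_or_pos m with rfl | hm
    · simp [char_zero hk]
    rw [tsum_char_pair hk hχ₂ hε ha ha' haa hm]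
    ring
  have hD := charPartial_zero_eq hk χ₁ J
  rw [hsum', sum_add_distrib, ← mul_sum, ← mul_sum]
  simp only [Function.comp]
  rw [hε] at hD
  -- With C = `charLambert χ₂ 0`, the relation χ₂(-1)C = -C turns the factor (1 - χ₂(-1))C into 2C.
  linear_combination (-charLambert χ₂ 0 / 2) * hD +
    (-1 / 2 * ∑ m ∈ range (J * k), χ₁ (m : ZMod k) / m) * hz

end

/-! ### A Lambert series and its inversion -/

/-- The Lambert series `∑ 1 / (n (e^(2nx) - 1))`. -/
def lambertF (x : ℝ) : ℝ := ∑' n : ℕ, 1 / (n : ℝ) * (1 / (Real.exp (2 * n * x) - 1))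

theorem exp_sub_one_pos {x : ℝ} (hx : 0 < x) {n : ℕ} (hn : 0 < n) :
    2 * n * x ≤ Real.exp (2 * n * x) - 1 ∧ 0 < 2 * n * x := by
  have hn' : (0 : ℝ) < n := by exact_mod_cast hn
  exact ⟨by linarith [Real.add_one_le_exp (2 * n * x)], by positivity⟩

theorem summable_lambertF {x : ℝ} (hx : 0 < x) :
    Summable fun n : ℕ => 1 / (n : ℝ) * (1 / (Real.exp (2 * n * x) - 1)) := by
  refine Summable.of_norm_bounded (g := fun n : ℕ => 1 / (2 * x) * (1 / (n : ℝ) ^ 2))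
    ((Real.summable_one_div_nat_pow.2 one_lt_two).mul_left _) fun n => ?_
  rcases Nat.eq_zero_or_pos n with rfl | hn
  · simp
  have hn' : (0 : ℝ) < n := by exact_mod_cast hn
  obtain ⟨h1, h2⟩ := exp_sub_one_pos hx hn
  rw [Real.norm_of_nonneg (mul_nonneg (by positivity) (one_div_nonneg.2 (h2.le.trans h1)))]
  calc _ ≤ 1 / (n : ℝ) * (1 / (2 * n * x)) :=
        mul_le_mul_of_nonneg_left (one_div_le_one_div_of_le h2 h1) (by positivity)
    _ = _ := by field_simp

/-- Expand 1/(e^(2nx) - 1) as a geometric series in q^n and sum over n first; all terms are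
nonnegative, so the order is free. -/
theorem hasSum_log_one_sub {x : ℝ} (hx : 0 < x) :
    HasSum (fun j : ℕ => Real.log (1 - Real.exp (-(2 * x)) ^ (j + 1))) (-lambertF x) := by
  set q := Real.exp (-(2 * x)) with hq
  have hq0 : 0 < q := Real.exp_pos _
  have hq1 : q < 1 := by
    rw [← Real.exp_zero]
    exact Real.exp_lt_exp.2 (by linarith)
  have hpow1 : ∀ n : ℕ, q ^ (n + 1) < 1 := fun n => pow_lt_one₀ hq0.le hq1 (by omega)
  have hH : ∀ n : ℕ, HasSum (fun j : ℕ => 1 / ((n + 1 : ℕ) : ℝ) * (q ^ (n + 1)) ^ (j + 1))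
      (1 / ((n + 1 : ℕ) : ℝ) * (1 / (Real.exp (2 * (n + 1 : ℕ) * x) - 1))) := by
    intro n
    have h1 := ((hasSum_geometric_of_lt_one (by positivity) (hpow1 n)).mul_left
      (q ^ (n + 1))).mul_left (1 / ((n + 1 : ℕ) : ℝ))
    have h2 : Real.exp (2 * (n + 1 : ℕ) * x) = (q ^ (n + 1))⁻¹ := by
      rw [hq, ← Real.exp_nat_mul, ← Real.exp_neg]
      congr 1
      ring
    have h3 : q ^ (n + 1) ≠ 0 := by positivity
    have h4 : 1 - q ^ (n + 1) ≠ 0 := (sub_pos.2 (hpow1 n)).ne'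
    have e : 1 / ((q ^ (n + 1))⁻¹ - 1) = q ^ (n + 1) * (1 - q ^ (n + 1))⁻¹ := by
      have : (q ^ (n + 1))⁻¹ - 1 = (1 - q ^ (n + 1)) / q ^ (n + 1) := by field_simp
      rw [this, one_div_div, div_eq_mul_inv]
    rw [h2, e]
    refine h1.congr_fun fun j => ?_
    ring
  have hsum : Summable fun p : ℕ × ℕ => 1 / ((p.1 + 1 : ℕ) : ℝ) * (q ^ (p.1 + 1)) ^ (p.2 + 1) := by
    refine (summable_prod_of_nonneg fun p => by positivity).2 ⟨fun n => (hH n).summable, ?_⟩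
    simp_rw [fun n => (hH n).tsum_eq]
    exact (summable_nat_add_iff 1).2 (summable_lambertF hx)
  have htot : ∑' p : ℕ × ℕ, 1 / ((p.1 + 1 : ℕ) : ℝ) * (q ^ (p.1 + 1)) ^ (p.2 + 1) =
      lambertF x := by
    rw [hsum.tsum_prod' fun n => (hH n).summable, lambertF,
      (summable_lambertF hx).tsum_eq_zero_add]
    simp_rw [fun n => (hH n).tsum_eq]
    simp
  have h := hsum.hasSum
  rw [htot, ← (Equiv.prodComm ℕ ℕ).hasSum_iff] at h
  have hlog : ∀ j : ℕ, HasSum (fun n : ℕ => 1 / ((n + 1 : ℕ) : ℝ) * (q ^ (n + 1)) ^ (j + 1))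
      (-Real.log (1 - q ^ (j + 1))) := by
    intro j
    have := Real.hasSum_pow_div_log_of_abs_lt_one
      (by rw [abs_of_pos (by positivity)]; exact hpow1 j : |q ^ (j + 1)| < 1)
    refine this.congr_fun fun n => ?_
    rw [← pow_mul, ← pow_mul]
    push_cast
    ring
  have h' := (h.prod_fiberwise fun j => hlog j).neg
  simpa using h'

/-- The product Δ = q ∏ (1 - q^n)^24 has positive real factors on the imaginary axis, where q =
e^(-2πt). -/
theorem log_norm_discriminant {t : ℝ} (ht : 0 < t) (z : UpperHalfPlane) (hz : (z : ℂ) = t * I) :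
    Real.log ‖ModularForm.discriminant z‖ =
      -(2 * (Real.pi * t)) - 24 * lambertF (Real.pi * t) := by
  have hx : 0 < Real.pi * t := mul_pos Real.pi_pos ht
  have hq : Function.Periodic.qParam 1 (z : ℂ) = (Real.exp (-(2 * (Real.pi * t))) : ℝ) := by
    rw [Function.Periodic.qParam, hz]
    push_cast
    congr 1
    linear_combination 2 * Real.pi * t * Complex.I_sq
  set q := Real.exp (-(2 * (Real.pi * t))) with hqdef
  have hq0 : 0 < q := Real.exp_pos _
  have hq1 : q < 1 := by
    rw [← Real.exp_zero]
    exact Real.exp_lt_exp.2 (by linarith)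
  have hpos : ∀ n : ℕ, 0 < 1 - q ^ (n + 1) :=
    fun n => sub_pos.2 (pow_lt_one₀ hq0.le hq1 (by omega))
  have hlog := hasSum_log_one_sub hx
  rw [← hqdef] at hlog
  have hmul := ModularForm.multipliableLocallyUniformlyOn_eta.multipliable z.2
  have hprod : ‖∏' n : ℕ, (1 - ModularForm.eta_q n z)‖ = Real.exp (-lambertF (Real.pi * t)) := by
    rw [hmul.norm_tprod, ← hlog.tsum_eq, Real.rexp_tsum_eq_tprod hpos hlog.summable]
    refine tprod_congr fun n => ?_
    rw [ModularForm.eta_q, hq, ← Complex.ofReal_pow, ← Complex.ofReal_one, ← Complex.ofReal_sub,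
      Complex.norm_real, Real.norm_of_nonneg (hpos n).le]
  rw [ModularForm.discriminant_eq_q_prod, hmul.tprod_pow, norm_mul, norm_pow, hprod, hq,
    Complex.norm_real, Real.norm_of_nonneg hq0.le, Real.log_mul hq0.ne' (by positivity),
    Real.log_pow, Real.log_exp, Real.log_exp]
  push_cast
  ring

/-- The inversion formula of the Dedekind eta function on the imaginary axis. -/
theorem lambertF_inversion {x : ℝ} (hx : 0 < x) :
    lambertF x - lambertF (Real.pi ^ 2 / x) =
      -x / 12 + Real.pi ^ 2 / (12 * x) + 1 / 2 * Real.log (x / Real.pi) := by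
  have hpi := Real.pi_pos
  set t := x / Real.pi with ht
  have ht0 : 0 < t := by positivity
  let z : UpperHalfPlane := ⟨t * I, by simpa using ht0⟩
  have hz : (z : ℂ) = t * I := rfl
  have hS : ((ModularGroup.S • z : UpperHalfPlane) : ℂ) = (t⁻¹ : ℝ) * I := by
    rw [UpperHalfPlane.modular_S_smul]
    change (-(z : ℂ))⁻¹ = _
    have hI := Complex.I_ne_zero
    have : (t : ℂ) ≠ 0 := by exact_mod_cast ht0.ne'
    rw [hz]
    push_cast
    field_simp
    rw [Complex.I_sq]
  -- Taking norms in the weight 12 invariance under z ↦ -1/z leaves the factor t^12 and avoids any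
  -- choice of branch.
  have h := congrFun ModularForm.discriminant_S_invariant z
  rw [ModularForm.SL_slash_apply, ModularGroup.denom_S] at h
  have hn : ‖ModularForm.discriminant (ModularGroup.S • z)‖ =
      ‖ModularForm.discriminant z‖ * t ^ 12 := by
    rw [← h, norm_mul, hz]
    have h1 : ‖((t : ℂ) * I) ^ (-(12 : ℤ))‖ = (t ^ 12)⁻¹ := by
      rw [norm_zpow, norm_mul, Complex.norm_real, Complex.norm_I, mul_one,
        Real.norm_of_nonneg ht0.le, zpow_neg]
      norm_cast
    rw [h1]
    field_simp
  have hl := congrArg Real.log hn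
  rw [Real.log_mul (norm_ne_zero_iff.2 (ModularForm.discriminant_ne_zero z)) (by positivity),
    log_norm_discriminant ht0 z hz, log_norm_discriminant (inv_pos.2 ht0) _ hS, Real.log_pow] at hl
  have e1 : Real.pi * t = x := by rw [ht]; field_simp
  have e2 : Real.pi * t⁻¹ = Real.pi ^ 2 / x := by rw [ht]; field_simp
  rw [e1, e2] at hl
  push_cast at hl
  have e3 : Real.pi ^ 2 / (12 * x) = (Real.pi ^ 2 / x) / 12 := by field_simp
  rw [e3]
  linarith

/-! ### The principal character through Möbius inversion -/

theorem sum_divisors_moebius (k : ℕ) :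
    ∑ d ∈ k.divisors, (ArithmeticFunction.moebius d : ℂ) = if k = 1 then 1 else 0 := by
  have h := congrArg (fun f => f k) ArithmeticFunction.moebius_mul_coe_zeta
  simp only [ArithmeticFunction.coe_mul_zeta_apply, ArithmeticFunction.one_apply] at h
  exact_mod_cast congrArg (Int.cast : ℤ → ℂ) h

theorem principal_eq_sum_moebius {k : ℕ} (hk : k ≠ 0) (n : ℕ) :
    (1 : DirichletCharacter ℂ k) (n : ZMod k) =
      ∑ d ∈ k.divisors, if d ∣ n then (ArithmeticFunction.moebius d : ℂ) else 0 := by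
  have h1 : k.divisors.filter (· ∣ n) = (k.gcd n).divisors := by
    ext d
    simp [Nat.dvd_gcd_iff, hk]
  rw [← sum_filter, h1, sum_divisors_moebius]
  split_ifs with h
  · exact MulChar.one_apply ((ZMod.isUnit_iff_coprime n k).2 (Nat.Coprime.symm h))
  · exact MulChar.map_nonunit _ fun hu => h ((ZMod.isUnit_iff_coprime n k).1 hu).symm

theorem sum_principal_mul {k : ℕ} (hk : k ≠ 0) (g : ℕ → ℂ) :
    ∑ v ∈ range k, (1 : DirichletCharacter ℂ k) (v : ZMod k) * g v =
      ∑ d ∈ k.divisors, (ArithmeticFunction.moebius d : ℂ) * ∑ u ∈ range (k / d), g (u * d) := by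
  simp_rw [principal_eq_sum_moebius hk, sum_mul]
  rw [sum_comm]
  refine sum_congr rfl fun d hd => ?_
  have hdk := Nat.dvd_of_mem_divisors hd
  have hd0 : 0 < d := Nat.pos_of_mem_divisors hd
  conv_lhs => rw [← Nat.div_mul_cancel hdk, sum_range_mul_blocks]
  rw [mul_sum]
  refine sum_congr rfl fun u _ => ?_
  rw [sum_eq_single_of_mem 0 (mem_range.2 hd0)]
  · simp
  · intro v hv hv0
    have : ¬ d ∣ v + u * d := by
      rw [Nat.dvd_add_left (dvd_mul_left d u)]
      exact fun h => hv0 (Nat.eq_zero_of_dvd_of_lt h (mem_range.1 hv))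
    simp [this]

/-- Each summand is ∑_{j<e} (ζ^u X)^j / (1 - X^e), and orthogonality of the roots of unity leaves
only j = 0. -/
theorem sum_one_div_one_sub_root {e : ℕ} {ζ X : ℂ} (he : e ≠ 0) (hζ : IsPrimitiveRoot ζ e)
    (hX : X ^ e ≠ 1) : ∑ u ∈ range e, 1 / (1 - ζ ^ u * X) = e / (1 - X ^ e) := by
  have hX' : 1 - X ^ e ≠ 0 := sub_ne_zero.2 (Ne.symm hX)
  have h1 : ∀ u, (ζ ^ u * X) ^ e = X ^ e := fun u => by
    rw [mul_pow, ← pow_mul, mul_comm, mul_comm u, pow_mul, hζ.pow_eq_one, one_pow, mul_one]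
  have h2 : ∀ u, 1 / (1 - ζ ^ u * X) = (∑ j ∈ range e, (ζ ^ u * X) ^ j) / (1 - X ^ e) := by
    intro u
    have h3 : 1 - ζ ^ u * X ≠ 0 := by
      intro h
      apply hX
      rw [← h1 u, ← sub_eq_zero.1 h, one_pow]
    rw [div_eq_div_iff h3 hX', one_mul, ← h1 u, geom_sum_mul_neg]
  simp_rw [h2]
  rw [← sum_div, sum_comm]
  congr 1
  rw [sum_eq_single_of_mem 0 (mem_range.2 (Nat.pos_of_ne_zero he))]
  · simp
  · intro j hj hj0
    have h3 : ζ ^ j ≠ 1 := hζ.pow_ne_one_of_pos_of_lt hj0 (mem_range.1 hj)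
    have h4 : (ζ ^ j) ^ e = 1 := by rw [← pow_mul, mul_comm, pow_mul, hζ.pow_eq_one, one_pow]
    have h5 := geom_sum_mul (ζ ^ j) e
    rw [h4, sub_self] at h5
    have h6 := (mul_eq_zero.1 h5).resolve_right (sub_ne_zero.2 h3)
    calc _ = ∑ u ∈ range e, X ^ j * (ζ ^ j) ^ u := by
          refine sum_congr rfl fun u _ => ?_
          rw [mul_pow, ← pow_mul, ← pow_mul, mul_comm u, mul_comm]
      _ = 0 := by rw [← mul_sum, h6, mul_zero]

/-- For v = ud the exponentials run over the (k/d)-th roots of unity. The constant 1 is split off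
because it does not depend on w: it makes each series diverge and cancels in the difference. -/
theorem charLambert_principal {k : ℕ} (hk : k ≠ 0) {w : ℝ} (hw : 0 < w) :
    charLambert (1 : DirichletCharacter ℂ k) w =
      ∑ d ∈ k.divisors, (ArithmeticFunction.moebius d : ℂ) *
        (((k / d : ℕ) : ℂ) * (1 + 1 / ((Real.exp ((k / d : ℕ) * w) : ℂ) - 1))) := by
  have h := sum_principal_mul hk fun v => 1 / (1 - Complex.exp (freq k * v - w))
  simp_rw [mul_one_div] at h
  rw [charLambert, h]
  refine sum_congr rfl fun d hd => ?_
  have hdk := Nat.dvd_of_mem_divisors hd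
  have hd0 : 0 < d := Nat.pos_of_mem_divisors hd
  obtain ⟨e, rfl⟩ := hdk
  have he : e ≠ 0 := fun h => hk (by simp [h])
  rw [Nat.mul_div_cancel_left e hd0]
  have hd0' : (d : ℂ) ≠ 0 := by exact_mod_cast hd0.ne'
  have he' : (e : ℂ) ≠ 0 := by exact_mod_cast he
  have hew : 0 < e * w := mul_pos (by exact_mod_cast Nat.pos_of_ne_zero he) hw
  have hE : (1 : ℝ) < Real.exp (e * w) := Real.one_lt_exp_iff.2 hew
  have hXe : Complex.exp (-w) ^ e = ((Real.exp (e * w) : ℝ) : ℂ)⁻¹ := by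
    rw [← Complex.exp_nat_mul, Complex.ofReal_exp, ← Complex.exp_neg]
    push_cast
    congr 1
    ring
  set E : ℂ := ((Real.exp (e * w) : ℝ) : ℂ) with hEdef
  have hE0 : E ≠ 0 := by rw [hEdef]; exact_mod_cast (Real.exp_pos _).ne'
  have hE1 : E - 1 ≠ 0 := sub_ne_zero.2 (by rw [hEdef]; exact_mod_cast hE.ne')
  have hroot := sum_one_div_one_sub_root (X := Complex.exp (-w)) he
    (Complex.isPrimitiveRoot_exp e he) (by
      rw [hXe]
      intro h
      exact hE1 (by rw [inv_eq_one.1 h, sub_self]))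
  have hlhs : ∑ u ∈ range e, 1 / (1 - Complex.exp (freq (d * e) * ((u * d : ℕ) : ℂ) - w)) =
      ∑ u ∈ range e, 1 / (1 - Complex.exp (2 * Real.pi * I / e) ^ u * Complex.exp (-w)) := by
    refine sum_congr rfl fun u _ => ?_
    rw [← Complex.exp_nat_mul, ← Complex.exp_add, freq]
    congr 3
    push_cast
    field_simp
    ring
  rw [hlhs, hroot, hXe]
  congr 1
  have : 1 - E⁻¹ ≠ 0 := by
    rw [show 1 - E⁻¹ = (E - 1) / E by field_simp]
    exact div_ne_zero hE1 hE0
  field_simp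
  ring

theorem hasSum_dvd {d : ℕ} (hd : 0 < d) (e : ℕ) (he : 0 < e) {x : ℝ} (hx : 0 < x) :
    HasSum (fun n : ℕ => (if d ∣ n then (1 : ℂ) else 0) *
        (((1 / (n : ℝ) * (1 / (Real.exp (e * (2 * n * x)) - 1)) : ℝ)) : ℂ))
      (((1 / (d : ℝ) * lambertF (d * e * x) : ℝ)) : ℂ) := by
  have hd' : (0 : ℝ) < d := by exact_mod_cast hd
  have he' : (0 : ℝ) < e := by exact_mod_cast he
  have hinj : Function.Injective fun n : ℕ => d * n := fun a b h => Nat.eq_of_mul_eq_mul_left hd h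
  rw [← hinj.hasSum_iff]
  · have h := ((summable_lambertF (by positivity : 0 < d * e * x)).hasSum.mul_left (1 / (d : ℝ)))
    refine (Complex.hasSum_ofReal.2 h).congr_fun fun n => ?_
    simp only [Function.comp, dvd_mul_right, if_true, one_mul]
    congr 1
    rw [Nat.cast_mul, show 2 * (n : ℝ) * (d * e * x) = e * (2 * (d * n) * x) by ring]
    simp only [one_div, mul_inv, mul_assoc]
  · intro n hn
    have : ¬ d ∣ n := fun ⟨m, hm⟩ => hn ⟨m, hm.symm⟩
    simp [this]

/-- Swapping d and d' in the θ-part makes the two arguments x and π²/x. After inversion the terms in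
x and 1/x contain the factor ∑ μ(d) = 0, and log d' - log d is antisymmetric; only log(kγ/π)
remains. -/
theorem sum_moebius_lambertF {k : ℕ} (hk : 2 ≤ k) {γ θ : ℝ} (hγ : 0 < γ)
    (h : γ * θ = Real.pi ^ 2 / (k : ℝ) ^ 2) :
    ∑ d' ∈ k.divisors, ∑ d ∈ k.divisors,
      (ArithmeticFunction.moebius d' : ℝ) * ((ArithmeticFunction.moebius d : ℝ) * ((k / d : ℝ) *
        (1 / (d' : ℝ) * lambertF (d' * (k / d) * γ) - 1 / (d' : ℝ) * lambertF (d' * (k / d) * θ)))) =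
    k / 2 * Real.log (k * γ / Real.pi) *
      (∑ d ∈ k.divisors, (ArithmeticFunction.moebius d : ℝ) / d) ^ 2 := by
  have hpi := Real.pi_pos
  have hk0 : (0 : ℝ) < k := by exact_mod_cast (by omega : 0 < k)
  have hθ : θ = Real.pi ^ 2 / ((k : ℝ) ^ 2 * γ) := by
    field_simp
    field_simp at h
    linarith
  have hM0 : ∑ d ∈ k.divisors, (ArithmeticFunction.moebius d : ℝ) = 0 := by
    have := sum_divisors_moebius k
    rw [if_neg (by omega)] at this
    exact_mod_cast this
  set μ : ℕ → ℝ := fun d => (ArithmeticFunction.moebius d : ℝ) with hμ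
  have hsplit : (∑ d' ∈ k.divisors, ∑ d ∈ k.divisors,
      μ d' * (μ d * ((k / d : ℝ) * (1 / (d' : ℝ) * lambertF (d' * (k / d) * γ) -
        1 / (d' : ℝ) * lambertF (d' * (k / d) * θ))))) =
      ∑ d' ∈ k.divisors, ∑ d ∈ k.divisors, μ d' * μ d * (k / (d * d')) *
        (lambertF (d' * (k / d) * γ) - lambertF (d * (k / d') * θ)) := by
    have e1 : (∑ d' ∈ k.divisors, ∑ d ∈ k.divisors,
        μ d' * μ d * (k / (d * d')) * lambertF (d * (k / d') * θ)) =
        ∑ d' ∈ k.divisors, ∑ d ∈ k.divisors,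
        μ d' * μ d * (k / (d * d')) * lambertF (d' * (k / d) * θ) := by
      rw [sum_comm]
      refine sum_congr rfl fun d' _ => sum_congr rfl fun d _ => ?_
      ring
    simp_rw [mul_sub, sum_sub_distrib]
    rw [e1]
    congr 1 <;>
    · refine sum_congr rfl fun d' _ => sum_congr rfl fun d _ => ?_
      ring
  rw [hsplit]
  have hterm : ∀ d' ∈ k.divisors, ∀ d ∈ k.divisors, μ d' * μ d * (k / (d * d')) *
        (lambertF (d' * (k / d) * γ) - lambertF (d * (k / d') * θ)) =
      μ d' * (-((k : ℝ) ^ 2 * γ / 12) * (μ d / (d : ℝ) ^ 2)) +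
        Real.pi ^ 2 / (12 * γ) * (μ d' / (d' : ℝ) ^ 2) * μ d +
        k / 2 * Real.log (k * γ / Real.pi) * (μ d' / d') * (μ d / d) +
        (k / 2 * (μ d' / d' * Real.log d') * (μ d / d) -
          k / 2 * (μ d' / d') * (μ d / d * Real.log d)) := by
    intro d' hd' d hd
    have h1 : (0 : ℝ) < d' := by exact_mod_cast Nat.pos_of_mem_divisors hd'
    have h2 : (0 : ℝ) < d := by exact_mod_cast Nat.pos_of_mem_divisors hd
    have hinv := lambertF_inversion (by positivity : 0 < d' * (k / d) * γ)
    have e1 : Real.pi ^ 2 / (d' * (k / d) * γ) = d * (k / d') * θ := by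
      rw [hθ]
      field_simp
    have e2 : Real.log (d' * (k / d) * γ / Real.pi) =
        Real.log (k * γ / Real.pi) + Real.log d' - Real.log d := by
      rw [← Real.log_mul (by positivity) (by positivity),
        ← Real.log_div (by positivity) (by positivity)]
      congr 1
      field_simp
    rw [e1, e2] at hinv
    rw [hinv]
    field_simp
    ring
  rw [sum_congr rfl fun d' hd' => sum_congr rfl (hterm d' hd')]
  simp_rw [sum_add_distrib, sum_sub_distrib, ← mul_sum, ← sum_mul, ← mul_sum]
  rw [hM0]
  ring

theorem sum_principal_eq {k : ℕ} (hk : k ≠ 0) :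
    ∑ v ∈ range k, (1 : DirichletCharacter ℂ k) (v : ZMod k) =
      ((k * ∑ d ∈ k.divisors, (ArithmeticFunction.moebius d : ℝ) / d : ℝ) : ℂ) := by
  have h := sum_principal_mul hk fun _ => 1
  simp only [mul_one, sum_const, card_range, nsmul_eq_mul] at h
  rw [h]
  push_cast
  rw [mul_sum]
  refine sum_congr rfl fun d hd => ?_
  rw [Nat.cast_div (Nat.dvd_of_mem_divisors hd)
    (by exact_mod_cast (Nat.pos_of_mem_divisors hd).ne')]
  ring

theorem hasSum_principal {k : ℕ} (hk : 2 ≤ k) {γ θ : ℝ} (hγ : 0 < γ) (hθ : 0 < θ)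
    (h : γ * θ = Real.pi ^ 2 / (k : ℝ) ^ 2) :
    HasSum (fun n : ℕ => (1 : DirichletCharacter ℂ k) (n : ZMod k) / n *
      (charLambert (1 : DirichletCharacter ℂ k) ((2 * n * γ : ℝ) : ℂ) -
        charLambert (1 : DirichletCharacter ℂ k) ((2 * n * θ : ℝ) : ℂ)))
      ((∑ v ∈ range k, (1 : DirichletCharacter ℂ k) (v : ZMod k)) ^ 2 / (2 * k) *
        (Real.log (k * γ / Real.pi) : ℝ)) := by
  have hk0 : k ≠ 0 := by omega
  have hkC : (k : ℂ) ≠ 0 := by exact_mod_cast hk0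
  have hS := congrArg (fun x : ℝ => (x : ℂ)) (sum_moebius_lambertF hk hγ h)
  have hval : (∑ v ∈ range k, (1 : DirichletCharacter ℂ k) (v : ZMod k)) ^ 2 / (2 * k) *
        ((Real.log (k * γ / Real.pi) : ℝ) : ℂ) = ∑ d' ∈ k.divisors, ∑ d ∈ k.divisors,
      (ArithmeticFunction.moebius d' : ℂ) * ((ArithmeticFunction.moebius d : ℂ) * (((k / d : ℕ) : ℂ) *
        (((1 / (d' : ℝ) * lambertF (d' * (k / d : ℕ) * γ) : ℝ) : ℂ) -
          ((1 / (d' : ℝ) * lambertF (d' * (k / d : ℕ) * θ) : ℝ) : ℂ)))) := by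
    rw [sum_principal_eq hk0]
    trans ((k / 2 * Real.log (k * γ / Real.pi) *
      (∑ d ∈ k.divisors, (ArithmeticFunction.moebius d : ℝ) / d) ^ 2 : ℝ) : ℂ)
    · push_cast
      field_simp
    · rw [← hS]
      push_cast
      refine sum_congr rfl fun d' hd' => sum_congr rfl fun d hd => ?_
      have e : ∀ {F : Type} [Field F] [CharZero F], ((k / d : ℕ) : F) = k / d := fun {F} _ _ =>
        Nat.cast_div (Nat.dvd_of_mem_divisors hd)
          (by exact_mod_cast (Nat.pos_of_mem_divisors hd).ne')
      rw [e, e]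
  rw [hval]
  have hT := hasSum_sum (s := k.divisors) fun d' hd' => hasSum_sum (s := k.divisors) fun d hd =>
    ((((hasSum_dvd (Nat.pos_of_mem_divisors hd') (k / d)
      (Nat.div_pos (Nat.le_of_dvd (by omega) (Nat.dvd_of_mem_divisors hd))
        (Nat.pos_of_mem_divisors hd)) hγ).sub
      (hasSum_dvd (Nat.pos_of_mem_divisors hd') (k / d)
      (Nat.div_pos (Nat.le_of_dvd (by omega) (Nat.dvd_of_mem_divisors hd))
        (Nat.pos_of_mem_divisors hd)) hθ)).mul_left ((k / d : ℕ) : ℂ)).mul_left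
        (ArithmeticFunction.moebius d : ℂ)).mul_left (ArithmeticFunction.moebius d' : ℂ)
  refine hT.congr_fun fun n => ?_
  rcases Nat.eq_zero_or_pos n with rfl | hn
  · simp
  have hn' : (0 : ℝ) < n := by exact_mod_cast hn
  rw [charLambert_principal hk0 (by positivity : 0 < 2 * n * γ),
    charLambert_principal hk0 (by positivity : 0 < 2 * n * θ), principal_eq_sum_moebius hk0,
    ← sum_sub_distrib, sum_div, sum_mul]
  refine sum_congr rfl fun d' _ => ?_
  rw [mul_sum]
  refine sum_congr rfl fun d _ => ?_
  push_cast
  split_ifs <;> ring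

/-! ### The right-hand side for principal characters -/

theorem ramanujanSum_eq_charGauss {k : ℕ} (hk : 2 ≤ k) :
    ramanujanSum k = charGauss (1 : DirichletCharacter ℂ k) := by
  funext n
  have h0 := char_zero hk (1 : DirichletCharacter ℂ k)
  rw [ramanujanSum, charGauss, sum_filter, range_eq_Ico, sum_eq_sum_Ico_succ_bot (by omega),
    Nat.cast_zero, h0, zero_mul, zero_add, ← Ico_succ_right_eq_Icc,
    Order.succ_eq_add_one, sum_Ico_succ_top (by omega)]
  rw [if_neg (by rw [Nat.coprime_self]; omega), add_zero]
  refine sum_congr rfl fun v _ => ?_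
  split_ifs with h
  · rw [MulChar.one_apply ((ZMod.isUnit_iff_coprime v k).2 h), one_mul]
  · rw [MulChar.map_nonunit _ fun hu => h ((ZMod.isUnit_iff_coprime v k).1 hu), zero_mul]

/-- The substitution v ↦ k - v replaces E by E⁻¹, and 1/(1 - E) + 1/(1 - E⁻¹) = 1; so the value at 0
is half the character sum. -/
theorem periodicBernoulliP_ramanujanSum {k : ℕ} (hk : 2 ≤ k) :
    periodicBernoulliP k 1 0 (ramanujanSum k) =
      -(∑ v ∈ range k, (1 : DirichletCharacter ℂ k) (v : ZMod k)) / 2 := by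
  set χ : DirichletCharacter ℂ k := 1
  have hkC : (k : ℂ) ≠ 0 := by exact_mod_cast (by omega : k ≠ 0)
  have h0 := char_zero hk χ
  have hrev : charLambert χ 0 =
      ∑ v ∈ range k, χ (v : ZMod k) / (1 - Complex.exp (-(freq k * v))) := by
    rw [charLambert, sum_range_reverse _ _ (by simp [h0]) (by simp [h0])]
    refine sum_congr rfl fun v hv => ?_
    have hv' := (mem_range.1 hv).le
    have e1 : χ ((k - v : ℕ) : ZMod k) = χ (v : ZMod k) := by
      rw [Nat.cast_sub hv', ZMod.natCast_self, zero_sub, ← neg_one_mul, map_mul,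
        MulChar.one_apply isUnit_one.neg, one_mul]
    rw [e1, Nat.cast_sub hv']
    have e2 : freq k * (k - v) - 0 = -(freq k * v) + 2 * Real.pi * I := by
      rw [freq]
      field_simp
      ring
    rw [e2, Complex.exp_periodic]
  have hsum : charLambert χ 0 + charLambert χ 0 = ∑ v ∈ range k, χ (v : ZMod k) := by
    nth_rw 2 [hrev]
    rw [charLambert, ← sum_add_distrib]
    refine sum_congr rfl fun v hv => ?_
    by_cases hχ : χ (v : ZMod k) = 0
    · simp [hχ]
    rw [sub_zero, Complex.exp_neg]
    have hE0 := Complex.exp_ne_zero (freq k * v)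
    have hE1 : 1 - Complex.exp (freq k * v) ≠ 0 := one_sub_exp_freq_ne_zero hk χ v (mem_range.1 hv) hχ
    set E := Complex.exp (freq k * v)
    rw [show 1 - E⁻¹ = -(1 - E) / E by field_simp; ring]
    field_simp
    ring
  rw [ramanujanSum_eq_charGauss hk, periodicBernoulliP_charGauss hk]
  linear_combination hsum / 2

/-- Here z lies on the positive imaginary axis; the πi/2 in log z cancels the product of the two P_1
values, so the result is real. -/
theorem rightSide_principal {k : ℕ} (hk : 2 ≤ k) {γ : ℝ} (hγ : 0 < γ) :
    rightSide (1 : DirichletCharacter ℂ k) 1 γ =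
      (∑ v ∈ range k, (1 : DirichletCharacter ℂ k) (v : ZMod k)) ^ 2 / (2 * k) *
        (Real.log (k * γ / Real.pi) : ℝ) := by
  have hk0 : (0 : ℝ) < k := by exact_mod_cast (by omega : 0 < k)
  have hkC : (k : ℂ) ≠ 0 := by exact_mod_cast hk0.ne'
  have hpi := Real.pi_pos
  have hP := periodicBernoulliP_ramanujanSum hk
  have hc : ramanujanSum k 0 = ∑ v ∈ range k, (1 : DirichletCharacter ℂ k) (v : ZMod k) := by
    rw [ramanujanSum_eq_charGauss hk, charGauss]
    simp
  have hlog : Complex.log (((1 : ℤ) : ℂ) * ((Real.pi : ℂ) * I / ((k : ℂ) * (γ : ℂ))) + ((0 : ℤ) : ℂ)) =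
      -(Real.log (k * γ / Real.pi) : ℝ) + Real.pi / 2 * I := by
    have e : ((1 : ℤ) : ℂ) * ((Real.pi : ℂ) * I / ((k : ℂ) * (γ : ℂ))) + ((0 : ℤ) : ℂ) =
        ((Real.pi / (k * γ) : ℝ) : ℂ) * I := by
      push_cast
      ring
    rw [e, Complex.log_ofReal_mul (by positivity) Complex.I_ne_zero, Complex.log_I,
      ← Complex.ofReal_neg, ← Real.log_inv, inv_div]
  rw [rightSide, logTerm, if_pos ⟨rfl, rfl⟩, hlog, hc, ← ramanujanSum_eq_charGauss hk, hP,
    MulChar.one_apply isUnit_one.neg]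
  field_simp
  ring

/-! ### The two cases of the identity -/

theorem freq_sq {k : ℕ} {γ θ : ℝ} (h : γ * θ = Real.pi ^ 2 / (k : ℝ) ^ 2) :
    ((2 * γ : ℝ) : ℂ) * ((2 * θ : ℝ) : ℂ) = -freq k ^ 2 := by
  have h' : (γ : ℂ) * θ = Real.pi ^ 2 / (k : ℂ) ^ 2 := by exact_mod_cast congrArg (Complex.ofReal) h
  rw [freq, div_pow, mul_pow, Complex.I_sq]
  push_cast
  linear_combination 4 * h'

theorem seriesTerm_eq_ofReal {k : ℕ} (χ₁ χ₂ : DirichletCharacter ℂ k) (γ : ℝ) (n : ℕ) :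
    seriesTerm χ₁ χ₂ γ n =
      χ₂ (n : ZMod k) / n * charLambert χ₁ ((2 * γ * n : ℝ) : ℂ) := by
  rw [seriesTerm_eq]
  push_cast
  ring_nf

theorem char_neg_one_eq {k : ℕ} {χ₁ χ₂ : DirichletCharacter ℂ k} (h : χ₁ (-1) * χ₂ (-1) = 1) :
    χ₁ (-1) = χ₂ (-1) := by
  linear_combination (-χ₁ (-1)) * char_neg_one_sq χ₂ + χ₂ (-1) * h

theorem nonprincipal_identity {k : ℕ} (hk : 2 ≤ k) {χ₁ χ₂ : DirichletCharacter ℂ k}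
    (h : χ₁ (-1) * χ₂ (-1) = 1) {γ θ : ℝ} (hγ : 0 < γ) (hθ : 0 < θ)
    (hγθ : γ * θ = Real.pi ^ 2 / (k : ℝ) ^ 2) (hχ₁ : χ₁ ≠ 1) (hχ₂ : χ₂ ≠ 1) :
    Summable (fun n : ℕ => seriesTerm χ₁ χ₂ γ (n + 1)) ∧
    Summable (fun n : ℕ => seriesTerm χ₂ χ₁ θ (n + 1)) ∧
    (∑' n : ℕ, seriesTerm χ₁ χ₂ γ (n + 1)) - χ₂ (-1) * (∑' n : ℕ, seriesTerm χ₂ χ₁ θ (n + 1)) =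
      rightSide χ₁ χ₂ γ := by
  have : NeZero k := ⟨by omega⟩
  have e1 : seriesTerm χ₁ χ₂ γ = _ := funext (seriesTerm_eq_ofReal χ₁ χ₂ γ)
  have e2 : seriesTerm χ₂ χ₁ θ = _ := funext (seriesTerm_eq_ofReal χ₂ χ₁ θ)
  -- The term n = 0 is zero because division by zero gives zero, so the sums may start at n = 1.
  have z1 : seriesTerm χ₁ χ₂ γ 0 = 0 := by simp [seriesTerm_eq_ofReal]
  have z2 : seriesTerm χ₂ χ₁ θ 0 = 0 := by simp [seriesTerm_eq_ofReal]
  have s1 := summable_series hk χ₂ hχ₁ (mul_pos two_pos hγ)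
  have s2 := summable_series hk χ₁ hχ₂ (mul_pos two_pos hθ)
  have hr := series_reciprocity hk hχ₁ hχ₂ (char_neg_one_eq h) (mul_pos two_pos hγ)
    (mul_pos two_pos hθ) (freq_sq hγθ)
  rw [← e1] at s1 hr
  rw [← e2] at s2 hr
  refine ⟨(summable_nat_add_iff 1).2 s1, (summable_nat_add_iff 1).2 s2, ?_⟩
  rw [s1.tsum_eq_zero_add, s2.tsum_eq_zero_add, z1, z2, zero_add, zero_add] at hr
  have hl : logTerm ((Real.pi : ℂ) * I / ((k : ℂ) * (γ : ℂ))) 1 0 χ₁ χ₂ = 0 :=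
    if_neg fun h => hχ₁ h.1
  rw [hr, rightSide, hl, periodicBernoulliP_charGauss hk, periodicBernoulliP_charGauss hk,
    sum_eq_zero_of_ne_one χ₁ hχ₁, sum_eq_zero_of_ne_one χ₂ hχ₂, freq]
  ring

theorem principal_identity {k : ℕ} (hk : 2 ≤ k) {γ θ : ℝ} (hγ : 0 < γ) (hθ : 0 < θ)
    (hγθ : γ * θ = Real.pi ^ 2 / (k : ℝ) ^ 2) :
    HasSum (fun n : ℕ => seriesTerm (1 : DirichletCharacter ℂ k) 1 γ (n + 1) -
      (1 : DirichletCharacter ℂ k) (-1) * seriesTerm (1 : DirichletCharacter ℂ k) 1 θ (n + 1))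
      (rightSide (1 : DirichletCharacter ℂ k) 1 γ) := by
  have h := hasSum_principal hk hγ hθ hγθ
  rw [← rightSide_principal hk hγ, ← hasSum_nat_add_iff' 1] at h
  simp only [sum_range_one, Nat.cast_zero, div_zero, zero_mul, sub_zero] at h
  refine h.congr_fun fun n => ?_
  rw [MulChar.one_apply isUnit_one.neg, seriesTerm_eq_ofReal, seriesTerm_eq_ofReal, one_mul,
    ← mul_sub, mul_right_comm 2 γ, mul_right_comm 2 θ]

/-! ### Evaluations modulo 6 and 3 -/

/-- With a = 2π/k the two terms are complex conjugates, and their denominators multiply to e^(-w)(2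
cosh w - 2 cos a). -/
theorem charLambert_of_two_terms {k : ℕ} (hk : 1 ≤ k) (χ : DirichletCharacter ℂ k)
    (hχ : ∀ f : ℕ → ℂ, ∑ v ∈ range k, χ (v : ZMod k) * f v = f 1 - f (k - 1)) (w : ℝ)
    (hw : 2 * Real.cosh w - 2 * Real.cos (2 * Real.pi / k) ≠ 0) :
    charLambert χ w = I * (2 * Real.sin (2 * Real.pi / k) : ℝ) /
      ((2 * Real.cosh w - 2 * Real.cos (2 * Real.pi / k) : ℝ) : ℂ) := by
  have hkC : (k : ℂ) ≠ 0 := by exact_mod_cast (by omega : k ≠ 0)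
  have h := hχ fun v => 1 / (1 - Complex.exp (freq k * v - w))
  simp_rw [mul_one_div] at h
  rw [charLambert, h]
  set a : ℝ := 2 * Real.pi / k with ha
  have hfa : freq k = a * I := by
    rw [freq, ha]
    push_cast
    ring
  have h1 : Complex.exp (freq k * ((1 : ℕ) : ℂ) - w) =
      (Complex.cos a + Complex.sin a * I) * Complex.exp (-w) := by
    rw [Nat.cast_one, mul_one, sub_eq_add_neg, Complex.exp_add, hfa, Complex.exp_mul_I]
  have h2 : Complex.exp (freq k * ((k - 1 : ℕ) : ℂ) - w) =
      (Complex.cos a - Complex.sin a * I) * Complex.exp (-w) := by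
    have e : freq k * ((k - 1 : ℕ) : ℂ) - w = -a * I + -w + 2 * Real.pi * I := by
      rw [Nat.cast_sub hk, Nat.cast_one, mul_sub, mul_one, hfa, ha]
      push_cast
      field_simp
      ring
    rw [e, Complex.exp_periodic, Complex.exp_add, Complex.exp_mul_I, Complex.cos_neg,
      Complex.sin_neg]
    ring
  rw [h1, h2]
  have hw' : ((2 * Real.cosh w - 2 * Real.cos a : ℝ) : ℂ) ≠ 0 := by exact_mod_cast hw
  have hX : Complex.exp (-w) ≠ 0 := Complex.exp_ne_zero _
  have hcosh : 2 * Complex.cosh w * Complex.exp (-w) = 1 + Complex.exp (-w) ^ 2 := by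
    rw [Complex.two_cosh, add_mul, ← Complex.exp_add, add_neg_cancel, Complex.exp_zero]
    ring
  have hcs := Complex.sin_sq_add_cos_sq (a : ℂ)
  set X := Complex.exp (-w)
  push_cast at hw' ⊢
  set C := Complex.cos (a : ℂ)
  set S := Complex.sin (a : ℂ)
  have hprod : (1 - (C + S * I) * X) * (1 - (C - S * I) * X) =
      X * (2 * Complex.cosh w - 2 * C) := by
    linear_combination X ^ 2 * hcs - hcosh - X ^ 2 * S ^ 2 * Complex.I_sq
  have hne : (1 - (C + S * I) * X) * (1 - (C - S * I) * X) ≠ 0 := by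
    rw [hprod]
    exact mul_ne_zero hX hw'
  rw [div_sub_div _ _ (left_ne_zero_of_mul hne) (right_ne_zero_of_mul hne), hprod,
    div_eq_div_iff (mul_ne_zero hX hw') hw']
  ring

/-- With χ₁ = χ₂ = χ odd, the factor -χ(-1) = 1 turns the difference into a sum. The right side is
-(πi/k)(i√3/(2 + c))², divided by the common factor i√3; in the applications c = -2 cos(2π/k) and √3
= 2 sin(2π/k). -/
theorem odd_evaluation {k : ℕ} (hk : 2 ≤ k) {χ : DirichletCharacter ℂ k} (hodd : χ (-1) = -1)
    {c : ℝ} (hc : ∀ w : ℝ, charLambert χ w =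
      I * (Real.sqrt 3 : ℝ) / ((2 * Real.cosh w + c : ℝ) : ℂ))
    {γ θ : ℝ} (hγ : 0 < γ) (hθ : 0 < θ) (hγθ : γ * θ = Real.pi ^ 2 / (k : ℝ) ^ 2) :
    Summable (fun n : ℕ => χ ((n + 1 : ℕ) : ZMod k) /
      (((n + 1 : ℕ) : ℂ) * ((2 * Real.cosh (2 * ((n + 1 : ℕ) : ℝ) * γ) + c : ℝ) : ℂ))) ∧
    Summable (fun n : ℕ => χ ((n + 1 : ℕ) : ZMod k) /
      (((n + 1 : ℕ) : ℂ) * ((2 * Real.cosh (2 * ((n + 1 : ℕ) : ℝ) * θ) + c : ℝ) : ℂ))) ∧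
    (∑' n : ℕ, χ ((n + 1 : ℕ) : ZMod k) /
        (((n + 1 : ℕ) : ℂ) * ((2 * Real.cosh (2 * ((n + 1 : ℕ) : ℝ) * γ) + c : ℝ) : ℂ))) +
      (∑' n : ℕ, χ ((n + 1 : ℕ) : ZMod k) /
        (((n + 1 : ℕ) : ℂ) * ((2 * Real.cosh (2 * ((n + 1 : ℕ) : ℝ) * θ) + c : ℝ) : ℂ))) =
      ((Real.pi * Real.sqrt 3 / (k * (2 + c) ^ 2) : ℝ) : ℂ) := by
  have : NeZero k := ⟨by omega⟩
  have hχ : χ ≠ 1 := by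
    rintro rfl
    rw [MulChar.one_apply isUnit_one.neg] at hodd
    norm_num at hodd
  have h3 : ((Real.sqrt 3 : ℝ) : ℂ) ≠ 0 := by
    exact_mod_cast (Real.sqrt_pos.2 (by norm_num : (0 : ℝ) < 3)).ne'
  have hI := Complex.I_ne_zero
  have hterm : ∀ (x : ℝ) (n : ℕ), χ ((n + 1 : ℕ) : ZMod k) /
      (((n + 1 : ℕ) : ℂ) * ((2 * Real.cosh (2 * ((n + 1 : ℕ) : ℝ) * x) + c : ℝ) : ℂ)) =
      (I * (Real.sqrt 3 : ℝ))⁻¹ * seriesTerm χ χ x (n + 1) := by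
    intro x n
    rw [seriesTerm_eq_ofReal, hc, mul_right_comm 2 x, ← div_div]
    linear_combination (-(χ ((n + 1 : ℕ) : ZMod k) / ((n + 1 : ℕ) : ℂ) /
      ((2 * Real.cosh (2 * ((n + 1 : ℕ) : ℝ) * x) + c : ℝ) : ℂ))) *
      inv_mul_cancel₀ (mul_ne_zero hI h3)
  obtain ⟨s1, s2, hsum⟩ := nonprincipal_identity hk (by rw [hodd]; norm_num) hγ hθ hγθ hχ hχ
  simp_rw [hterm]
  refine ⟨s1.mul_left _, s2.mul_left _, ?_⟩
  rw [tsum_mul_left, tsum_mul_left, ← mul_add]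
  rw [hodd, neg_one_mul, sub_neg_eq_add] at hsum
  have h0 := hc 0
  rw [Real.cosh_zero, mul_one, Complex.ofReal_zero] at h0
  rw [hsum, rightSide, logTerm, if_neg fun h => hχ h.1, periodicBernoulliP_charGauss hk,
    sum_eq_zero_of_ne_one χ hχ, sub_zero, h0, hodd]
  push_cast
  field_simp
  ring_nf
  simp

theorem char_natCast_eq_zero {k : ℕ} (χ : DirichletCharacter ℂ k) {v : ℕ} (h : ¬ v.Coprime k) :
    χ (v : ZMod k) = 0 :=
  χ.map_nonunit fun hu => h ((ZMod.isUnit_iff_coprime v k).1 hu)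

theorem charLambert_mod_six (χ : DirichletCharacter ℂ 6) (hχ : χ 5 = -1) (w : ℝ) :
    charLambert χ w = I * (Real.sqrt 3 : ℝ) / ((2 * Real.cosh w + -1 : ℝ) : ℂ) := by
  have hs : ((6 : ℕ) : ℝ) = 6 := by norm_num
  have ha : 2 * Real.pi / ((6 : ℕ) : ℝ) = Real.pi / 3 := by rw [hs]; ring
  have h := charLambert_of_two_terms (by norm_num) χ (fun f => by
    have h0 := char_natCast_eq_zero χ (v := 0) (by decide)
    have h2 := char_natCast_eq_zero χ (v := 2) (by decide)
    have h3 := char_natCast_eq_zero χ (v := 3) (by decide)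
    have h4 := char_natCast_eq_zero χ (v := 4) (by decide)
    have h5 : χ ((5 : ℕ) : ZMod 6) = -1 := hχ
    simp only [sum_range_succ, sum_range_zero, h0, h2, h3, h4, h5, Nat.cast_one, map_one]
    ring) w (by
      rw [ha, Real.cos_pi_div_three]
      linarith [Real.one_le_cosh w])
  rw [h, ha, Real.cos_pi_div_three, Real.sin_pi_div_three]
  congr 3 <;> ring

theorem charLambert_mod_three (χ : DirichletCharacter ℂ 3) (hχ : χ 2 = -1) (w : ℝ) :
    charLambert χ w = I * (Real.sqrt 3 : ℝ) / ((2 * Real.cosh w + 1 : ℝ) : ℂ) := by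
  have hs : ((3 : ℕ) : ℝ) = 3 := by norm_num
  have ha : 2 * Real.pi / ((3 : ℕ) : ℝ) = Real.pi - Real.pi / 3 := by rw [hs]; ring
  have h := charLambert_of_two_terms (by norm_num) χ (fun f => by
    have h0 := char_natCast_eq_zero χ (v := 0) (by decide)
    have h2 : χ ((2 : ℕ) : ZMod 3) = -1 := hχ
    simp only [sum_range_succ, sum_range_zero, h0, h2, Nat.cast_one, map_one]
    ring) w (by
      rw [ha, Real.cos_pi_sub, Real.cos_pi_div_three]
      linarith [Real.one_le_cosh w])
  rw [h, ha, Real.cos_pi_sub, Real.sin_pi_sub, Real.cos_pi_div_three, Real.sin_pi_div_three]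
  congr 3 <;> ring

end CharSeries

end

theorem mainTheorem7 :
    -- the identity, for two non-principal or two principal characters modulo `k ≥ 2`
    (∀ (k : ℕ), 2 ≤ k → ∀ (χ₁ χ₂ : DirichletCharacter ℂ k), χ₁ (-1) * χ₂ (-1) = 1 →
      ∀ (γ θ : ℝ), 0 < γ → 0 < θ → γ * θ = Real.pi ^ 2 / (k : ℝ) ^ 2 →
        (χ₁ ≠ 1 → χ₂ ≠ 1 →
          Summable (fun n : ℕ => CharSeries.seriesTerm χ₁ χ₂ γ (n + 1)) ∧
          Summable (fun n : ℕ => CharSeries.seriesTerm χ₂ χ₁ θ (n + 1)) ∧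
          (∑' n : ℕ, CharSeries.seriesTerm χ₁ χ₂ γ (n + 1))
              - χ₂ (-1) * (∑' n : ℕ, CharSeries.seriesTerm χ₂ χ₁ θ (n + 1))
            = CharSeries.rightSide χ₁ χ₂ γ) ∧
        (χ₁ = 1 → χ₂ = 1 →
          HasSum (fun n : ℕ => CharSeries.seriesTerm χ₁ χ₂ γ (n + 1)
              - χ₂ (-1) * CharSeries.seriesTerm χ₂ χ₁ θ (n + 1))
            (CharSeries.rightSide χ₁ χ₂ γ))) ∧
    -- the evaluation for the non-principal character modulo 6
    (∀ (χ : DirichletCharacter ℂ 6), χ 5 = -1 →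
      ∀ (γ θ : ℝ), 0 < γ → 0 < θ → γ * θ = Real.pi ^ 2 / 36 →
        Summable (fun n : ℕ => χ ((n + 1 : ℕ) : ZMod 6) /
          (((n + 1 : ℕ) : ℂ) * ((2 * Real.cosh (2 * ((n + 1 : ℕ) : ℝ) * γ) - 1 : ℝ) : ℂ))) ∧
        Summable (fun n : ℕ => χ ((n + 1 : ℕ) : ZMod 6) /
          (((n + 1 : ℕ) : ℂ) * ((2 * Real.cosh (2 * ((n + 1 : ℕ) : ℝ) * θ) - 1 : ℝ) : ℂ))) ∧
        (∑' n : ℕ, χ ((n + 1 : ℕ) : ZMod 6) /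
            (((n + 1 : ℕ) : ℂ) * ((2 * Real.cosh (2 * ((n + 1 : ℕ) : ℝ) * γ) - 1 : ℝ) : ℂ)))
          + (∑' n : ℕ, χ ((n + 1 : ℕ) : ZMod 6) /
            (((n + 1 : ℕ) : ℂ) * ((2 * Real.cosh (2 * ((n + 1 : ℕ) : ℝ) * θ) - 1 : ℝ) : ℂ)))
          = ((Real.pi / (2 * Real.sqrt 3) : ℝ) : ℂ)) ∧
    -- the evaluation for the non-principal character modulo 3
    (∀ (χ : DirichletCharacter ℂ 3), χ 2 = -1 →
      ∀ (γ θ : ℝ), 0 < γ → 0 < θ → γ * θ = Real.pi ^ 2 / 9 →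
        Summable (fun n : ℕ => χ ((n + 1 : ℕ) : ZMod 3) /
          (((n + 1 : ℕ) : ℂ) * ((2 * Real.cosh (2 * ((n + 1 : ℕ) : ℝ) * γ) + 1 : ℝ) : ℂ))) ∧
        Summable (fun n : ℕ => χ ((n + 1 : ℕ) : ZMod 3) /
          (((n + 1 : ℕ) : ℂ) * ((2 * Real.cosh (2 * ((n + 1 : ℕ) : ℝ) * θ) + 1 : ℝ) : ℂ))) ∧
        (∑' n : ℕ, χ ((n + 1 : ℕ) : ZMod 3) /
            (((n + 1 : ℕ) : ℂ) * ((2 * Real.cosh (2 * ((n + 1 : ℕ) : ℝ) * γ) + 1 : ℝ) : ℂ)))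
          + (∑' n : ℕ, χ ((n + 1 : ℕ) : ZMod 3) /
            (((n + 1 : ℕ) : ℂ) * ((2 * Real.cosh (2 * ((n + 1 : ℕ) : ℝ) * θ) + 1 : ℝ) : ℂ)))
          = ((Real.pi / (9 * Real.sqrt 3) : ℝ) : ℂ)) := by
  refine ⟨fun k hk χ₁ χ₂ h γ θ hγ hθ hγθ =>
    ⟨fun h₁ h₂ => CharSeries.nonprincipal_identity hk h hγ hθ hγθ h₁ h₂, ?_⟩, ?_, ?_⟩
  · rintro rfl rfl
    exact CharSeries.principal_identity hk hγ hθ hγθ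
  · intro χ hχ γ θ hγ hθ hγθ
    -- -1 and 5 are the same residue modulo 6.
    have hodd : χ (-1) = -1 := by
      rw [← hχ]
      rfl
    have h := CharSeries.odd_evaluation (by norm_num) hodd (CharSeries.charLambert_mod_six χ hχ)
      hγ hθ (by rw [hγθ]; norm_num)
    have e : Real.pi * Real.sqrt 3 / (((6 : ℕ) : ℝ) * (2 + -1) ^ 2) =
        Real.pi / (2 * Real.sqrt 3) := by
      have h3 : Real.sqrt 3 ^ 2 = 3 := Real.sq_sqrt (by norm_num)
      push_cast
      rw [div_eq_div_iff (by norm_num) (by positivity)]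
      linear_combination 2 * Real.pi * h3
    rw [e] at h
    exact h
  · intro χ hχ γ θ hγ hθ hγθ
    have hodd : χ (-1) = -1 := by
      rw [← hχ]
      rfl
    have h := CharSeries.odd_evaluation (by norm_num) hodd (CharSeries.charLambert_mod_three χ hχ)
      hγ hθ (by rw [hγθ]; norm_num)
    have e : Real.pi * Real.sqrt 3 / (((3 : ℕ) : ℝ) * (2 + 1) ^ 2) =
        Real.pi / (9 * Real.sqrt 3) := by
      have h3 : Real.sqrt 3 ^ 2 = 3 := Real.sq_sqrt (by norm_num)
      push_cast
      rw [div_eq_div_iff (by norm_num) (by positivity)]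
      linear_combination 9 * Real.pi * h3
    rw [e] at h
    exact h
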